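/- For $n\ge 1$ let $S_n$ be the set of $n$-qubit stabilizer states (up to global phase). There are a constant $C$ and a family of basis-enhanced 2-gram models $M_{n,T}$ ($n,T\in\mathbb N$), i.e. Bayesian quantum circuits (sequences of uniformly controlled single-target gates applied to $|0\cdots0\rangle$ in which no qubit is targeted after it has been used as a control, followed by single-qubit measurements in arbitrary local bases) whose qubits are grouped into a chain of $T$ nodes such that the gates targeting node $t$ are controlled only by nodes $t-1$ and $t$ and by the $t$-th input, with the following properties for all $n\ge1$. (1) Each node of $M_{n,T}$ has a state space of dimension $D=D_n$, a power of $2$, with $2^n\le D\le 2^{Cn}$. (2) $M_{n,T}$ simulates Pauli measurements by teleportation gadgets: the $t$-th input $x_t$ is an $n$-qubit Pauli operator, the $t$-th output $y_t$ determines a sign $(-1)^{s(y_t)}$ and a Pauli operator $B(y_t)$, and for all $t<T$ the outputs $y_1,\dots,y_t$ have conditional probability $$q(y_1,\dots,y_t\mid x)=\Big(\frac{2}{D}\Big)^{t}\,\|\phi_t\|^2,\qquad \phi_0=|0\rangle^{\otimes n},\quad \phi_{i}=B(y_i)\,\frac{1+(-1)^{s(y_i)}x_i}{2}\,\phi_{i-1}.$$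 That is, $x_1,x_2,\dots$ are measured one after the other on a register of $n$ qubits, which after each measurement undergoes a teleportation byproduct that is known from the output. For every $t\ge Cn$, every state in $S_n$ is, up to normalization and phase, the register state $\phi_t$ of some history $(x_i,y_i)_{i\le t}$. (3) Let $T>t+2$ and $t\ge Cn$. Consider any classical hidden Markov model in translation form with $V$ hidden states (hidden state $h\to h'$ with probability $\alpha_t(h'\mid h,x_t)$, then emission of $y_t$ with probability $\beta_t(y_t\mid h')$), or any ontological model with $V$ hidden variables (outcome $y_t$ with probability $p_t(y_t\mid h,x_t)$, then update $h\to h'$ with probability $\Gamma_{t,x_t,y_t}(h'\mid h)$), whose conditional output distribution $p$ satisfies $p(y\mid x)=0\iff q(y\mid x)=0$ for all input and output sequences of length $T$. For $\psi\in S_n$ let $\operatorname{supp}(\psi)$ be the set of the hidden states that have positive probability after some history of length $t$ that leaves the register in the state $\psi$, and let $m$ be the maximal number of states in $S_n$ whose supports have a common element. Then $$V\;\ge\;\frac{|S_n|}{m}\;\ge\;2^{\,n^2/4-Cn}.$$ (4) There is a constant $c>0$ such that $2^{\,n^2/4-Cn}\ge D^{\,c\log_2 D}$ for all sufficiently large $n$;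 hence every such classical model needs $D^{\Omega(\log D)}$ hidden states. -/

import Mathlib

/-! ## Pauli operators, Pauli measurements and stabilizer states -/

/-- The four single-qubit Pauli operators. -/
inductive Pauli where
  | I | X | Y | Z

/-- The matrix of a single-qubit Pauli operator in the computational basis. -/
def Pauli.mat : Pauli → Matrix (Fin 2) (Fin 2) ℂ
  | .I => !![1, 0; 0, 1]
  | .X => !![0, 1; 1, 0]
  | .Y => !![0, -Complex.I; Complex.I, 0]
  | .Z => !![1, 0; 0, -1]

/-- An `n`-qubit Pauli operator (a tensor product of `n` single-qubit ones, without phase). -/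
abbrev PauliString (n : ℕ) : Type := Fin n → Pauli

/-- An `n`-qubit vector, given by its amplitudes in the computational basis. -/
abbrev QState (n : ℕ) : Type := (Fin n → Fin 2) → ℂ

/-- The `2 ^ n × 2 ^ n` matrix of the tensor product of the entries of a Pauli string. -/
def PauliString.op {n : ℕ} (P : PauliString n) :
    Matrix (Fin n → Fin 2) (Fin n → Fin 2) ℂ :=
  fun z w => ∏ i, (P i).mat (z i) (w i)

/-- The projector `(1 + (-1)^s P) / 2` belonging to the outcome `(-1)^s` of a measurement
of the observable `P`. -/
noncomputable def PauliString.proj {n : ℕ} (P : PauliString n) (s : Fin 2) :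
    Matrix (Fin n → Fin 2) (Fin n → Fin 2) ℂ :=
  (1 / 2 : ℂ) • (1 + (-1 : ℂ) ^ (s : ℕ) • P.op)

/-- The computational basis state `|0…0⟩`. -/
def zeroState (n : ℕ) : QState n := fun z => if z = 0 then 1 else 0

/-- The squared Euclidean norm of a vector. -/
noncomputable def QState.sqNorm {n : ℕ} (ψ : QState n) : ℝ := ∑ z, ‖ψ z‖ ^ 2

/-- The stabilizer group of a vector: the signed Pauli operators `(-1)^s P` that fix it.
(For a nonzero vector it is automatically abelian and does not contain `-1`, and the
operators `± i P` cannot fix it.) -/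
def stabilizerGroup {n : ℕ} (ψ : QState n) : Set (Fin 2 × PauliString n) :=
  {g | ((-1 : ℂ) ^ (g.1 : ℕ) • g.2.op).mulVec ψ = ψ}

/-- A (not necessarily normalized) stabilizer state: a nonzero vector whose stabilizer group
has the maximal order `2 ^ n`. -/
def IsStabilizerState {n : ℕ} (ψ : QState n) : Prop :=
  ψ ≠ 0 ∧ (stabilizerGroup ψ).ncard = 2 ^ n

/-- The set of all `n`-qubit stabilizer states. States are identified if they agree up to
normalization and global phase, so a state is recorded as the line spanned by it. -/
def stabilizerStates (n : ℕ) : Set (Submodule ℂ (QState n)) :=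
  {W | ∃ ψ : QState n, IsStabilizerState ψ ∧ W = Submodule.span ℂ {ψ}}

/-! ## Basis-enhanced Bayesian quantum circuits and 2-gram models -/

/-- A uniformly controlled gate on a set `Q` of qubits: if the control qubits are in the
computational basis state `v`, a single-qubit unitary `unitary x v` acts on the single target
qubit. The gate may in addition depend on a classical input `x : A`. -/
structure UCGate (Q A : Type) where
  target : Q
  controls : Finset Q
  target_notMem : target ∉ controls
  unitary : A → ({q // q ∈ controls} → Fin 2) → Matrix.unitaryGroup (Fin 2) ℂ

/-- The action of a uniformly controlled gate on a state of all qubits. -/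
noncomputable def UCGate.apply {Q A : Type} [DecidableEq Q] (g : UCGate Q A) (x : A)
    (ψ : (Q → Fin 2) → ℂ) : (Q → Fin 2) → ℂ :=
  fun z => ∑ b : Fin 2,
    (g.unitary x (fun q => z q) : Matrix (Fin 2) (Fin 2) ℂ) (z g.target) b *
      ψ (Function.update z g.target b)

/-- A basis-enhanced Bayesian quantum circuit on the qubits `Q` with classical input in `A`:
a sequence of uniformly controlled gates, applied to `|0…0⟩`, in which a qubit that has been
used as a control is never targeted afterwards, followed by a measurement of every qubit in
a local (single-qubit) orthonormal basis of its own, described by the unitary that rotates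
this basis to the computational one. -/
structure BBQC (Q A : Type) where
  gates : List (UCGate Q A)
  ordered : gates.Pairwise (fun g h => h.target ∉ g.controls)
  basis : Q → Matrix.unitaryGroup (Fin 2) ℂ

/-- The state of all qubits before the measurement. -/
noncomputable def BBQC.state {Q A : Type} [DecidableEq Q] [Fintype Q] (c : BBQC Q A) (x : A) :
    (Q → Fin 2) → ℂ :=
  c.gates.foldl (fun ψ g => g.apply x ψ) (fun z => if z = 0 then 1 else 0)

/-- The conditional probability `q(y | x)` of the measurement results `y` given the input. -/
noncomputable def BBQC.prob {Q A : Type} [DecidableEq Q] [Fintype Q] (c : BBQC Q A) (x : A)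
    (y : Q → Fin 2) : ℝ :=
  ‖∑ z : Q → Fin 2, (∏ q, (c.basis q : Matrix (Fin 2) (Fin 2) ℂ) (y q) (z q)) * c.state x z‖ ^ 2

/-- A basis-enhanced 2-gram model with input: the qubits are grouped into a chain of `T`
visible nodes of `k` qubits each (so a node has a state space of dimension `2 ^ k`), a gate
that targets a qubit of node `t` is controlled only by qubits of the nodes `t - 1` and `t`,
and it depends on the input sequence only through the `t`-th input. -/
def BBQC.IsTwoGram {T k : ℕ} {X : Type} (c : BBQC (Fin T × Fin k) (Fin T → X)) : Prop :=
  ∀ g ∈ c.gates,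
    (∀ q ∈ g.controls, q.1 = g.target.1 ∨ (q.1 : ℕ) + 1 = g.target.1) ∧
    (∀ x x' : Fin T → X, x g.target.1 = x' g.target.1 → g.unitary x = g.unitary x')

/-- `q(y | x)` for a chain of `T` nodes; only the first `T` terms of the sequences `x` of
inputs and `y` of node outputs matter. -/
noncomputable def BBQC.seqProb {T k : ℕ} {X : Type} (c : BBQC (Fin T × Fin k) (Fin T → X))
    (x : ℕ → X) (y : ℕ → Fin k → Fin 2) : ℝ :=
  c.prob (fun t => x t) (fun q => y q.1 q.2)

/-- The marginal probability, given the inputs `x`, that the first `t` nodes output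
`y 0, …, y (t - 1)`. -/
noncomputable def BBQC.prefixProb {T k : ℕ} {X : Type}
    (c : BBQC (Fin T × Fin k) (Fin T → X)) (t : ℕ) (x : ℕ → X) (y : ℕ → Fin k → Fin 2) : ℝ :=
  ∑ y' : Fin T × Fin k → Fin 2 with (∀ q, (q.1 : ℕ) < t → y' q = y q.1 q.2),
    c.prob (fun s => x s) y'

/-! ## Simulation of Pauli measurements by teleportation gadgets -/

/-- How the `k` output bits of a node are read: as the outcome of a Pauli measurement, and as
the Pauli byproduct that the teleportation to the next node leaves on the register. -/
structure Readout (n k : ℕ) where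
  outcome : (Fin k → Fin 2) → Fin 2
  byproduct : (Fin k → Fin 2) → PauliString n

/-- The unnormalized state of an `n`-qubit register, initially `|0…0⟩`, after `t` rounds with
inputs `x` and outputs `y`: in each round the Pauli operator `x i` is measured, with the outcome
that is read from `y i`, and then the register undergoes the Pauli byproduct that is read
from `y i`. -/
noncomputable def Readout.register {n k : ℕ} (r : Readout n k) (x : ℕ → PauliString n)
    (y : ℕ → Fin k → Fin 2) : ℕ → QState n
  | 0 => zeroState n
  | t + 1 => (r.byproduct (y t)).op.mulVec
      (((x t).proj (r.outcome (y t))).mulVec (r.register x y t))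

/-- The model simulates sequential Pauli measurements on `n` qubits through teleportation
gadgets: the outputs of the first `t` nodes have the Born probability of the measurement
outcomes read from them, times the probability of the teleportation results, which are
`k - 1` uniformly distributed bits per node. (The register that sits at the last node is
not teleported any further, hence `t < T`.) -/
def Simulates {n k T : ℕ} (r : Readout n k)
    (c : BBQC (Fin T × Fin k) (Fin T → PauliString n)) : Prop :=
  ∀ t < T, ∀ (x : ℕ → PauliString n) (y : ℕ → Fin k → Fin 2),
    c.prefixProb t x y = (2 / 2 ^ k : ℝ) ^ t * (r.register x y t).sqNorm

/-! ## Classical models -/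

/-- A hidden Markov model in translation form with `V` hidden states, input alphabet `X` and
output alphabet `Y`. At time `t` the hidden state `h` changes to `h'` with probability
`trans t h x h'` under the input `x`, and then `y` is emitted with probability `emit t h' y`.
The kernels may depend on the time; translationally invariant models are a special case. -/
structure TranslationHMM (V : ℕ) (X Y : Type) [Fintype Y] where
  init : Fin V → ℝ
  trans : ℕ → Fin V → X → Fin V → ℝ
  emit : ℕ → Fin V → Y → ℝ
  init_mem : init ∈ stdSimplex ℝ (Fin V)
  trans_mem : ∀ t h x, trans t h x ∈ stdSimplex ℝ (Fin V)
  emit_mem : ∀ t h, emit t h ∈ stdSimplex ℝ Y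

/-- `forward x y t h` is the joint probability, given the inputs `x`, of the first `t` outputs
`y 0, …, y (t - 1)` and of the hidden state `h` after them. -/
noncomputable def TranslationHMM.forward {V : ℕ} {X Y : Type} [Fintype Y]
    (H : TranslationHMM V X Y) (x : ℕ → X) (y : ℕ → Y) : ℕ → Fin V → ℝ
  | 0 => H.init
  | t + 1 => fun h' => ∑ h, H.forward x y t h * (H.trans t h (x t) h' * H.emit t h' (y t))

/-- An ontological model with `V` hidden variables: at time `t`, a measurement `x` on the hidden
variable `h` has the outcome `y` with probability `resp t h x y`, and then `h` changes to `h'`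
with probability `update t h x y h'`. -/
structure OntologicalModel (V : ℕ) (X Y : Type) [Fintype Y] where
  init : Fin V → ℝ
  resp : ℕ → Fin V → X → Y → ℝ
  update : ℕ → Fin V → X → Y → Fin V → ℝ
  init_mem : init ∈ stdSimplex ℝ (Fin V)
  resp_mem : ∀ t h x, resp t h x ∈ stdSimplex ℝ Y
  update_mem : ∀ t h x y, update t h x y ∈ stdSimplex ℝ (Fin V)

/-- The joint probability, given the inputs `x`, of the first `t` outputs and of the hidden
variable `h` after them. -/
noncomputable def OntologicalModel.forward {V : ℕ} {X Y : Type} [Fintype Y]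
    (O : OntologicalModel V X Y) (x : ℕ → X) (y : ℕ → Y) : ℕ → Fin V → ℝ
  | 0 => O.init
  | t + 1 => fun h' =>
      ∑ h, O.forward x y t h * (O.resp t h (x t) (y t) * O.update t h (x t) (y t) h')

/-- A classical model with joint probabilities `p` of outputs and hidden state has the same
zero/nonzero pattern as the quantum model: `p(y | x) = 0 ↔ q(y | x) = 0` for all input and
output sequences of length `T`. -/
def SamePattern {V T k : ℕ} {X : Type}
    (p : (ℕ → X) → (ℕ → Fin k → Fin 2) → ℕ → Fin V → ℝ)
    (c : BBQC (Fin T × Fin k) (Fin T → X)) : Prop :=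
  ∀ x y, ∑ h, p x y T h = 0 ↔ c.seqProb x y = 0

/-- The support of a quantum state `W` at time `t`: the hidden states in which the classical
model can be after some history of length `t` that leaves the quantum register in `W`. -/
def hiddenSupport {V n k : ℕ} (r : Readout n k)
    (p : (ℕ → PauliString n) → (ℕ → Fin k → Fin 2) → ℕ → Fin V → ℝ) (t : ℕ)
    (W : Submodule ℂ (QState n)) : Set (Fin V) :=
  {h | ∃ x y, p x y t h ≠ 0 ∧ Submodule.span ℂ {r.register x y t} = W}

/-- The maximal number of stabilizer states whose supports at time `t` have a common hidden
state. -/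
noncomputable def maxShared {V n k : ℕ} (r : Readout n k)
    (p : (ℕ → PauliString n) → (ℕ → Fin k → Fin 2) → ℕ → Fin V → ℝ) (t : ℕ) : ℕ :=
  sSup {m | ∃ s : Finset (Submodule ℂ (QState n)), (s : Set (Submodule ℂ (QState n))) ⊆
    stabilizerStates n ∧ (⋂ W ∈ s, hiddenSupport r p t W).Nonempty ∧ s.card = m}

/-- The lower bounds `2 ^ (n² / 4 - C n) ≤ |S| / m ≤ V` on the number `V` of hidden states,
where `S` is the set of stabilizer states. -/
def HiddenStateBound {V n k : ℕ} (C : ℕ) (r : Readout n k)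
    (p : (ℕ → PauliString n) → (ℕ → Fin k → Fin 2) → ℕ → Fin V → ℝ) (t : ℕ) : Prop :=
  (2 : ℝ) ^ ((n : ℝ) ^ 2 / 4 - C * n) ≤ ((stabilizerStates n).ncard : ℝ) / maxShared r p t ∧
  ((stabilizerStates n).ncard : ℝ) / maxShared r p t ≤ V

/-! Up to phase, Pauli operators form the space `PauliVec n` of dimension `2n` over `ZMod 2`, and
two of them commute exactly when the symplectic form `symp` vanishes. A stabilizer state amounts to
a Lagrangian subspace together with a sign for each of its elements
(`IsStabilizerState.exists_smul_eq`).

Quantum model. Each node holds an ancilla, `n` link qubits and `n` data qubits. Ancilla and links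
are prepared and measured in the X basis; data qubits are computed from them and from the previous
links. Summed over all computational paths, a node contributes the matrix of a Pauli projector
followed by a Pauli byproduct, times a scalar of fixed modulus (`exists_sum_nodeAmp`). The full
amplitude is thus an overlap of the register with the all-ones vector, and averaging over the
byproducts of the last node turns this overlap into a norm (`QState.sum_norm_ip_sq`). Every
stabilizer state is reached in `n + 1` rounds: one byproduct makes the overlap with the target
nonzero, then `n` generators are measured.

Classical models. Let several states share a hidden state `h`. From `h`, pick an outcome of positive
probability for each Pauli `P`, and after it one for each `Q`. Because zero patterns agree, no state
of the family is annihilated by these two projections (`IsStochastic.exists_outcomes`). The first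
outcomes give one sign per Pauli, common to all states. Measuring `v + w` and then `v` shows that
these signs are multiplicative on commuting pairs, even if `v` and `w` stabilize different states
(`PauliVec.exists_consistentSigns`).

Counting. The Mermin square limits such signs: if Lagrangians `L₂`, `L₃` of the family meet `L₁` in
the same subspace, then `L₂ ⊓ L₃` has index at most 4 in `L₃` (`ConsistentSigns.exists_near`), so
`L₃` is determined by `L₂` and two vectors. Hence at most (number of subspaces of `L₁`) · `16 ^ n`,
which is `2 ^ (n²/4 + O(n))`, states share a hidden state. Graph states show that there are at least
`2 ^ (n (n - 1) / 2)` stabilizer states; the hidden states cover all of them, and the quotient is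
the bound. -/

open Matrix

/-! ## The algebra of Pauli operators -/

/-- The single-qubit Pauli operator with given `X` and `Z` exponents. -/
def Pauli.ofBits (p : ZMod 2 × ZMod 2) : Pauli :=
  if p.1 = 0 then (if p.2 = 0 then .I else .Z) else (if p.2 = 0 then .X else .Y)

/-- The exponents of a single-qubit Pauli operator. -/
def Pauli.bits : Pauli → ZMod 2 × ZMod 2
  | .I => (0, 0)
  | .X => (1, 0)
  | .Y => (1, 1)
  | .Z => (0, 1)

theorem Pauli.ofBits_bits (p : Pauli) : Pauli.ofBits p.bits = p := by cases p <;> rfl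

theorem Pauli.bits_ofBits (p : ZMod 2 × ZMod 2) : (Pauli.ofBits p).bits = p := by
  revert p; decide

/-- The sign character of `ZMod 2`. -/
def signChar (a : ZMod 2) : ℂ := (-1 : ℂ) ^ a.val

theorem zmod_two_cases (a : ZMod 2) : a = 0 ∨ a = 1 := by revert a; decide

@[simp] theorem signChar_zero : signChar 0 = 1 := by simp [signChar]

@[simp] theorem signChar_one : signChar 1 = -1 := by simp [signChar, ZMod.val_one]

theorem signChar_add (a b : ZMod 2) : signChar (a + b) = signChar a * signChar b := by
  rcases zmod_two_cases a with rfl | rfl <;> rcases zmod_two_cases b with rfl | rfl <;>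
    simp [show (1 + 1 : ZMod 2) = 0 from rfl]

theorem signChar_sum {ι : Type*} (s : Finset ι) (f : ι → ZMod 2) :
    signChar (∑ i ∈ s, f i) = ∏ i ∈ s, signChar (f i) := by
  classical
  induction s using Finset.induction_on with
  | empty => simp
  | insert i s hi ih => rw [Finset.sum_insert hi, Finset.prod_insert hi, signChar_add, ih]

theorem signChar_eq_one_iff (a : ZMod 2) : signChar a = 1 ↔ a = 0 := by
  rcases zmod_two_cases a with rfl | rfl
  · simp
  · simp only [signChar_one, one_ne_zero, iff_false]; norm_num

theorem Pauli.mat_mul_self (p : Pauli) : p.mat * p.mat = 1 := by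
  cases p <;> simp [Pauli.mat, Matrix.one_fin_two]

theorem Pauli.mat_conjTranspose (p : Pauli) : p.matᴴ = p.mat := by
  cases p <;> ext i j <;> fin_cases i <;> fin_cases j <;> simp [Pauli.mat]

theorem Pauli.mat_mul_comm (p q : ZMod 2 × ZMod 2) :
    (Pauli.ofBits p).mat * (Pauli.ofBits q).mat =
      signChar (p.1 * q.2 + p.2 * q.1) • ((Pauli.ofBits q).mat * (Pauli.ofBits p).mat) := by
  obtain ⟨a, b⟩ := p
  obtain ⟨c, d⟩ := q
  rcases zmod_two_cases a with rfl | rfl <;> rcases zmod_two_cases b with rfl | rfl <;>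
  rcases zmod_two_cases c with rfl | rfl <;> rcases zmod_two_cases d with rfl | rfl <;>
    simp [Pauli.ofBits, Pauli.mat, show (1 + 1 : ZMod 2) = 0 from rfl]

theorem Pauli.exists_mat_mul (p q : ZMod 2 × ZMod 2) :
    ∃ c : ℂ, (Pauli.ofBits p).mat * (Pauli.ofBits q).mat = c • (Pauli.ofBits (p + q)).mat := by
  obtain ⟨a, b⟩ := p
  obtain ⟨c, d⟩ := q
  rcases zmod_two_cases a with rfl | rfl <;> rcases zmod_two_cases b with rfl | rfl <;>
  rcases zmod_two_cases c with rfl | rfl <;> rcases zmod_two_cases d with rfl | rfl <;>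
  first
  | (refine ⟨1, ?_⟩; simp [Pauli.ofBits, Pauli.mat, show (1 + 1 : ZMod 2) = 0 from rfl]; done)
  | (refine ⟨Complex.I, ?_⟩
     simp [Pauli.ofBits, Pauli.mat, show (1 + 1 : ZMod 2) = 0 from rfl]; done)
  | (refine ⟨-Complex.I, ?_⟩; simp [Pauli.ofBits, Pauli.mat, show (1 + 1 : ZMod 2) = 0 from rfl])

/-- The Pauli matrices are an orthogonal basis of the 2 × 2 matrices, each of squared
Hilbert–Schmidt norm 2; this is the completeness relation of that basis. -/
theorem Pauli.mat_completeness (z w z' w' : Fin 2) :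
    ∑ p : ZMod 2 × ZMod 2, (Pauli.ofBits p).mat z w * (Pauli.ofBits p).mat w' z' =
      if z = z' ∧ w = w' then 2 else 0 := by
  have h : ∀ f : ZMod 2 × ZMod 2 → ℂ, ∑ p, f p = f (0, 0) + f (0, 1) + f (1, 0) + f (1, 1) := by
    intro f
    rw [Fintype.sum_prod_type]
    change ∑ x : Fin 2, ∑ y : Fin 2, f (x, y) = _
    simp only [Fin.sum_univ_two]
    exact (add_assoc _ _ _).symm
  rw [h]
  fin_cases z <;> fin_cases w <;> fin_cases z' <;> fin_cases w' <;>
    simp [Pauli.ofBits, Pauli.mat] <;> norm_num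

/-- The `ZMod 2` vector space of the exponents of `n`-qubit Pauli operators. -/
abbrev PauliVec (n : ℕ) : Type := Fin n → ZMod 2 × ZMod 2

namespace PauliVec

variable {n : ℕ}

/-- The Pauli string with given exponents. -/
def toString (v : PauliVec n) : PauliString n := fun i => Pauli.ofBits (v i)

theorem toString_bits (P : PauliString n) : toString (fun i => (P i).bits) = P := by
  funext i; exact Pauli.ofBits_bits _

/-- Exponents and Pauli strings correspond to each other. -/
def equivString (n : ℕ) : PauliVec n ≃ PauliString n where
  toFun := toString
  invFun P i := (P i).bits
  left_inv v := funext fun i => Pauli.bits_ofBits (v i)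
  right_inv := toString_bits

/-- The Pauli operator with given exponents. -/
abbrev op (v : PauliVec n) : Matrix (Fin n → Fin 2) (Fin n → Fin 2) ℂ := v.toString.op

/-- The symplectic form, which tells whether Pauli operators commute. -/
def symp (n : ℕ) : LinearMap.BilinForm (ZMod 2) (PauliVec n) :=
  LinearMap.mk₂ (ZMod 2) (fun v w => ∑ i, ((v i).1 * (w i).2 + (v i).2 * (w i).1))
    (by intro a b c; rw [← Finset.sum_add_distrib]; congr 1; funext i; simp; ring)
    (by intro a b c; rw [Finset.smul_sum]; congr 1; funext i; simp; ring)
    (by intro a b c; rw [← Finset.sum_add_distrib]; congr 1; funext i; simp; ring)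
    (by intro a b c; rw [Finset.smul_sum]; congr 1; funext i; simp; ring)

theorem symp_apply (v w : PauliVec n) :
    symp n v w = ∑ i, ((v i).1 * (w i).2 + (v i).2 * (w i).1) := rfl

theorem symp_comm (v w : PauliVec n) : symp n v w = symp n w v := by
  simp only [symp_apply]; congr 1; funext i; ring

theorem add_self_zero (v : PauliVec n) : v + v = 0 := by
  funext i
  have : ∀ a : ZMod 2 × ZMod 2, a + a = 0 := by decide
  exact this (v i)

theorem symp_self (v : PauliVec n) : symp n v v = 0 := by
  rw [symp_apply]
  refine Finset.sum_eq_zero fun i _ => ?_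
  have : ∀ a b : ZMod 2, a * b + b * a = 0 := by decide
  exact this _ _

theorem symp_isRefl : (symp n).IsRefl := fun v w h => by rw [symp_comm]; exact h

theorem symp_nondegenerate : (symp n).Nondegenerate := by
  have key : ∀ v : PauliVec n, (∀ w, symp n v w = 0) → v = 0 := by
    intro v h
    funext i
    -- Pairing with `Z` and `X` on qubit `i` reads off the two exponents of `v` there.
    have h1 := h (Pi.single i (0, 1))
    have h2 := h (Pi.single i (1, 0))
    rw [symp_apply, Finset.sum_eq_single i (by intro j _ hj; simp [Pi.single_eq_of_ne hj])
      (by simp)] at h1 h2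
    simp at h1 h2
    exact Prod.ext h1 h2
  exact ⟨key, fun v h => key v fun w => by rw [symp_comm]; exact h w⟩

theorem finrank_eq : Module.finrank (ZMod 2) (PauliVec n) = 2 * n := by
  rw [Module.finrank_pi_fintype]
  simp [mul_comm]

end PauliVec

/-- Tensor products multiply factorwise: the sum over intermediate bit strings of a product is the
product of the sums over single bits. -/
theorem PauliString.op_mul_apply {n : ℕ} (P Q : PauliString n) (z w : Fin n → Fin 2) :
    (P.op * Q.op) z w = ∏ i, ((P i).mat * (Q i).mat) (z i) (w i) := by
  simp only [Matrix.mul_apply, PauliString.op, ← Finset.prod_mul_distrib]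
  rw [Finset.prod_univ_sum, Fintype.piFinset_univ]

theorem PauliString.op_mul_self {n : ℕ} (P : PauliString n) : P.op * P.op = 1 := by
  ext z w
  rw [PauliString.op_mul_apply]
  simp only [Pauli.mat_mul_self, Matrix.one_apply]
  rw [Finset.prod_ite_zero]
  simp [funext_iff]

theorem PauliString.op_conjTranspose {n : ℕ} (P : PauliString n) : P.opᴴ = P.op := by
  ext z w
  simp only [Matrix.conjTranspose_apply, PauliString.op, star_prod]
  refine Finset.prod_congr rfl fun i _ => ?_
  rw [← Matrix.conjTranspose_apply, Pauli.mat_conjTranspose]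

namespace PauliVec

variable {n : ℕ}

theorem op_mul_comm (v w : PauliVec n) : v.op * w.op = signChar (symp n v w) • (w.op * v.op) := by
  ext z y
  rw [Matrix.smul_apply, PauliString.op_mul_apply, PauliString.op_mul_apply, symp_apply,
    signChar_sum, smul_eq_mul, ← Finset.prod_mul_distrib]
  refine Finset.prod_congr rfl fun i _ => ?_
  simp only [toString]
  rw [Pauli.mat_mul_comm (v i) (w i), Matrix.smul_apply, smul_eq_mul]

theorem exists_op_mul (v w : PauliVec n) : ∃ c : ℂ, v.op * w.op = c • (v + w).op := by
  choose c hc using Pauli.exists_mat_mul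
  refine ⟨∏ i, c (v i) (w i), ?_⟩
  ext z y
  rw [Matrix.smul_apply, PauliString.op_mul_apply, smul_eq_mul]
  simp only [op, PauliString.op]
  rw [← Finset.prod_mul_distrib]
  refine Finset.prod_congr rfl fun i _ => ?_
  simp only [toString, hc, Matrix.smul_apply, smul_eq_mul, Pi.add_apply]

theorem op_zero : (0 : PauliVec n).op = 1 := by
  ext z w
  have : Pauli.mat (Pauli.ofBits 0) = 1 := by
    simp [Pauli.ofBits, Pauli.mat, Matrix.one_fin_two]
  simp only [PauliString.op, toString, Pi.zero_apply, this, Matrix.one_apply]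
  rw [Finset.prod_ite_zero]
  simp [funext_iff]

/-- The product of commuting Pauli operators is a Pauli operator up to a sign. -/
theorem exists_op_mul_of_symp {v w : PauliVec n} (h : symp n v w = 0) :
    ∃ c : ℂ, c * c = 1 ∧ v.op * w.op = c • (v + w).op := by
  obtain ⟨c, hc⟩ := exists_op_mul v w
  refine ⟨c, ?_, hc⟩
  have hcomm := op_mul_comm v w
  rw [h, signChar_zero, one_smul] at hcomm
  -- A product of two commuting involutions is an involution, which forces `c * c = 1`.
  have h1 : (v.op * w.op) * (v.op * w.op) = 1 := by
    nth_rewrite 2 [hcomm]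
    rw [Matrix.mul_assoc, ← Matrix.mul_assoc w.op, PauliString.op_mul_self, Matrix.one_mul,
      PauliString.op_mul_self]
  rw [hc, Matrix.smul_mul, Matrix.mul_smul, PauliString.op_mul_self, smul_smul] at h1
  have := congrFun (congrFun h1 0) 0
  simpa using this

theorem op_completeness (z w z' w' : Fin n → Fin 2) :
    ∑ v : PauliVec n, v.op z w * v.op w' z' = if z = z' ∧ w = w' then 2 ^ n else 0 := by
  simp only [PauliString.op, toString, ← Finset.prod_mul_distrib]
  have := Finset.prod_univ_sum (fun _ : Fin n => (Finset.univ : Finset (ZMod 2 × ZMod 2)))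
    (fun i p => (Pauli.ofBits p).mat (z i) (w i) * (Pauli.ofBits p).mat (w' i) (z' i))
  rw [Fintype.piFinset_univ] at this
  rw [← this]
  simp only [Pauli.mat_completeness]
  rw [Finset.prod_ite_zero]
  simp [funext_iff, forall_and]

end PauliVec

/-! ## Inner products and norms -/

namespace QState

variable {n : ℕ}

/-- The Hermitian inner product. -/
def ip (u v : QState n) : ℂ := ∑ z, star (u z) * v z

theorem ip_self (u : QState n) : ip u u = (u.sqNorm : ℂ) := by
  simp only [ip, sqNorm, Complex.ofReal_sum]
  refine Finset.sum_congr rfl fun z _ => ?_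
  rw [Complex.star_def, mul_comm, Complex.mul_conj, Complex.normSq_eq_norm_sq]

theorem ip_mulVec (M : Matrix (Fin n → Fin 2) (Fin n → Fin 2) ℂ) (u v : QState n) :
    ip u (M *ᵥ v) = ip (Mᴴ *ᵥ u) v := by
  simp only [ip, mulVec, dotProduct, star_sum, Finset.sum_mul, Finset.mul_sum, star_mul',
    conjTranspose_apply, star_star]
  rw [Finset.sum_comm]
  refine Finset.sum_congr rfl fun z _ => Finset.sum_congr rfl fun w _ => ?_
  ring

theorem ip_add (u v w : QState n) : ip u (v + w) = ip u v + ip u w := by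
  simp [ip, mul_add, Finset.sum_add_distrib]

theorem ip_sub (u v w : QState n) : ip u (v - w) = ip u v - ip u w := by
  simp [ip, mul_sub, Finset.sum_sub_distrib]

theorem ip_smul (c : ℂ) (u v : QState n) : ip u (c • v) = c * ip u v := by
  simp only [ip, Finset.mul_sum, Pi.smul_apply, smul_eq_mul]
  exact Finset.sum_congr rfl fun z _ => by ring

theorem sqNorm_eq_zero_iff (u : QState n) : u.sqNorm = 0 ↔ u = 0 := by
  rw [sqNorm, Finset.sum_eq_zero_iff_of_nonneg (fun _ _ => by positivity)]
  simp [funext_iff]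

theorem sqNorm_op (P : PauliString n) (u : QState n) : sqNorm (P.op *ᵥ u) = u.sqNorm := by
  have : ((sqNorm (P.op *ᵥ u) : ℝ) : ℂ) = (u.sqNorm : ℝ) := by
    rw [← ip_self, ← ip_self, ip_mulVec, PauliString.op_conjTranspose, mulVec_mulVec,
      PauliString.op_mul_self, one_mulVec]
  exact_mod_cast this

/-- The Pauli operators form a unitary 2-design of the first order: summed over all Pauli
operators, the squared matrix elements depend only on the norms. -/
theorem sum_norm_ip_sq (u v : QState n) :
    ∑ b : PauliVec n, ‖ip u (b.op *ᵥ v)‖ ^ 2 = 2 ^ n * (u.sqNorm * v.sqNorm) := by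
  have key : ((∑ b : PauliVec n, ‖ip u (b.op *ᵥ v)‖ ^ 2 : ℝ) : ℂ) =
      ((2 ^ n * (u.sqNorm * v.sqNorm) : ℝ) : ℂ) := by
    push_cast
    have h1 : ∀ b : PauliVec n, (‖ip u (b.op *ᵥ v)‖ : ℂ) ^ 2 =
        ∑ z, ∑ w, ∑ z', ∑ w', (star (u z) * v w * (star (v w') * u z')) *
          (b.op z w * b.op w' z') := by
      intro b
      rw [← Complex.mul_conj', ← Complex.star_def]
      have e1 : ip u (b.op *ᵥ v) = ∑ z, ∑ w, star (u z) * v w * b.op z w := by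
        simp only [ip, mulVec, dotProduct, Finset.mul_sum]
        exact Finset.sum_congr rfl fun z _ => Finset.sum_congr rfl fun w _ => by ring
      have e2 : star (ip u (b.op *ᵥ v)) = ∑ z', ∑ w', star (v w') * u z' * b.op w' z' := by
        rw [e1]
        simp only [star_sum, star_mul', star_star]
        refine Finset.sum_congr rfl fun z _ => Finset.sum_congr rfl fun w _ => ?_
        have := congrFun (congrFun (PauliString.op_conjTranspose b.toString) w) z
        rw [conjTranspose_apply] at this
        rw [this]; ring
      rw [e2, e1]
      rw [Finset.sum_mul]
      refine Finset.sum_congr rfl fun z _ => ?_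
      rw [Finset.sum_mul]
      refine Finset.sum_congr rfl fun w _ => ?_
      rw [Finset.mul_sum]
      refine Finset.sum_congr rfl fun z' _ => ?_
      rw [Finset.mul_sum]
      refine Finset.sum_congr rfl fun w' _ => ?_
      ring
    simp only [h1]
    -- The sum over `b` is moved inside the four sums over bit strings, where `op_completeness`
    -- evaluates it.
    rw [Finset.sum_comm]
    have h2 : ∀ z w, ∑ b : PauliVec n, ∑ z', ∑ w',
        (star (u z) * v w * (star (v w') * u z')) * (b.op z w * b.op w' z') =
        2 ^ n * (star (u z) * u z * (star (v w) * v w)) := by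
      intro z w
      rw [Finset.sum_comm]
      have : ∀ z', ∑ b : PauliVec n, ∑ w', (star (u z) * v w * (star (v w') * u z')) *
          (b.op z w * b.op w' z') = ∑ w', (star (u z) * v w * (star (v w') * u z')) *
          (if z = z' ∧ w = w' then 2 ^ n else 0) := by
        intro z'
        rw [Finset.sum_comm]
        refine Finset.sum_congr rfl fun w' _ => ?_
        rw [← Finset.mul_sum, PauliVec.op_completeness]
      simp only [this, ite_and]
      simp
      ring
    have h3 : ∀ z, ∑ b : PauliVec n, ∑ w, ∑ z', ∑ w',
        (star (u z) * v w * (star (v w') * u z')) * (b.op z w * b.op w' z') =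
        ∑ w, 2 ^ n * (star (u z) * u z * (star (v w) * v w)) := by
      intro z
      rw [Finset.sum_comm]
      exact Finset.sum_congr rfl fun w _ => h2 z w
    simp only [h3, ← Finset.mul_sum, ← Finset.sum_mul]
    rw [← ip_self, ← ip_self]
    rfl
  exact_mod_cast key

/-- Irreducibility of the Pauli group. It yields both the uniqueness of a state with given
stabilizers and the byproduct that starts the preparation of a stabilizer state. -/
theorem eq_zero_of_ip_op_eq_zero {u v : QState n} (h : ∀ b : PauliVec n, ip u (b.op *ᵥ v) = 0) :
    u = 0 ∨ v = 0 := by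
  have := sum_norm_ip_sq u v
  simp only [h] at this
  simp at this
  rcases this with h | h
  · exact .inl ((sqNorm_eq_zero_iff u).1 h)
  · exact .inr ((sqNorm_eq_zero_iff v).1 h)

theorem sum_sqNorm_proj (P : PauliString n) (u : QState n) :
    ∑ s, sqNorm (P.proj s *ᵥ u) = u.sqNorm := by
  -- The two projectors are Hermitian idempotents with sum 1, so this is Pythagoras.
  have hs : ∀ s : Fin 2, (P.proj s)ᴴ * P.proj s = P.proj s := by
    intro s
    have hst : (star ((-1 : ℂ) ^ (s : ℕ))) = (-1 : ℂ) ^ (s : ℕ) := by simp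
    have hh : ((-1 : ℂ) ^ (s : ℕ)) * ((-1 : ℂ) ^ (s : ℕ)) = 1 := by
      rw [← mul_pow]; simp
    rw [PauliString.proj, conjTranspose_smul, conjTranspose_add, conjTranspose_one,
      conjTranspose_smul, PauliString.op_conjTranspose, hst, smul_mul_smul_comm]
    rw [add_mul, mul_add, mul_add, smul_mul_smul_comm, hh, PauliString.op_mul_self]
    simp only [one_mul, mul_one, one_smul]
    ext i j
    simp
    ring
  have key : ((∑ s, sqNorm (P.proj s *ᵥ u) : ℝ) : ℂ) = (u.sqNorm : ℝ) := by
    push_cast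
    simp only [← ip_self]
    have : ∀ s, ip ((P.proj s) *ᵥ u) ((P.proj s) *ᵥ u) = ip u ((P.proj s) *ᵥ u) := by
      intro s
      have := ip_mulVec (P.proj s)ᴴ u ((P.proj s) *ᵥ u)
      rw [conjTranspose_conjTranspose, mulVec_mulVec, hs] at this
      exact this.symm
    simp only [this]
    rw [Fin.sum_univ_two, ← ip_add, ← add_mulVec]
    have : P.proj 0 + P.proj 1 = 1 := by
      ext i j
      simp [PauliString.proj]
      ring
    rw [this, one_mulVec]
  exact_mod_cast key

end QState

/-! ## Stabilizers -/

namespace PauliVec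

variable {n : ℕ}

theorem op_mulVec_op_mulVec (v : PauliVec n) (ψ : QState n) : v.op *ᵥ (v.op *ᵥ ψ) = ψ := by
  rw [mulVec_mulVec, PauliString.op_mul_self, one_mulVec]

theorem op_ne_zero (v : PauliVec n) : v.op ≠ 0 := by
  intro h
  have h2 := PauliString.op_mul_self v.toString
  rw [show v.toString.op = 0 from h, Matrix.mul_zero] at h2
  exact zero_ne_one h2

theorem exists_ne_zero_op_mul (v w : PauliVec n) :
    ∃ c : ℂ, c ≠ 0 ∧ v.op * w.op = c • (v + w).op := by
  obtain ⟨c, hc⟩ := exists_op_mul v w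
  refine ⟨c, ?_, hc⟩
  rintro rfl
  rw [zero_smul] at hc
  have : v.op * (v.op * w.op) = w.op := by
    rw [← Matrix.mul_assoc, PauliString.op_mul_self, Matrix.one_mul]
  rw [hc, Matrix.mul_zero] at this
  exact op_ne_zero w this.symm

theorem op_add_mulVec {v w : PauliVec n} {c : ℂ} (hc : c ≠ 0)
    (h : v.op * w.op = c • (v + w).op) {ψ : QState n} {a b : ℂ}
    (hv : v.op *ᵥ ψ = a • ψ) (hw : w.op *ᵥ ψ = b • ψ) :
    (v + w).op *ᵥ ψ = (c⁻¹ * (b * a)) • ψ := by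
  have h1 : (v.op * w.op) *ᵥ ψ = (b * a) • ψ := by
    rw [← mulVec_mulVec, hw, mulVec_smul, hv, smul_smul]
  rw [h, smul_mulVec] at h1
  rw [mul_smul, ← h1, smul_smul, inv_mul_cancel₀ hc, one_smul]

theorem eigenvalue_mul_self {v : PauliVec n} {ψ : QState n} (hψ : ψ ≠ 0) {a : ℂ}
    (h : v.op *ᵥ ψ = a • ψ) : a * a = 1 := by
  have h1 := op_mulVec_op_mulVec v ψ
  rw [h, mulVec_smul, h, smul_smul] at h1
  by_contra hne
  have : (a * a - 1) • ψ = 0 := by rw [sub_smul, h1, one_smul, sub_self]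
  rcases smul_eq_zero.1 this with h2 | h2
  · exact hne (sub_eq_zero.1 h2)
  · exact hψ h2

theorem eigenvalue_unique {ψ : QState n} (hψ : ψ ≠ 0) {a b : ℂ} (h : a • ψ = b • ψ) : a = b :=
  smul_left_injective ℂ hψ h

theorem exists_sign {a : ℂ} (h : a * a = 1) : ∃ s : Fin 2, (-1 : ℂ) ^ (s : ℕ) = a := by
  rcases mul_self_eq_one_iff.1 h with rfl | rfl
  · exact ⟨0, by simp⟩
  · exact ⟨1, by simp⟩

theorem sign_mul_self (s : Fin 2) : (-1 : ℂ) ^ (s : ℕ) * (-1 : ℂ) ^ (s : ℕ) = 1 := by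
  rw [← mul_pow]; simp

theorem sign_injective {s s' : Fin 2} (h : (-1 : ℂ) ^ (s : ℕ) = (-1 : ℂ) ^ (s' : ℕ)) : s = s' := by
  fin_cases s <;> fin_cases s' <;> first | rfl | (norm_num at h)

/-- Both orders of the product act on the common eigenvector by the same nonzero scalar, so the
commutation sign is 1. -/
theorem symp_eq_zero_of_eigen {v w : PauliVec n} {ψ : QState n} (hψ : ψ ≠ 0) {a b : ℂ}
    (hv : v.op *ᵥ ψ = a • ψ) (hw : w.op *ᵥ ψ = b • ψ) : symp n v w = 0 := by
  have h1 : (v.op * w.op) *ᵥ ψ = (b * a) • ψ := by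
    rw [← mulVec_mulVec, hw, mulVec_smul, hv, smul_smul]
  have h2 : (w.op * v.op) *ᵥ ψ = (b * a) • ψ := by
    rw [← mulVec_mulVec, hv, mulVec_smul, hw, smul_smul, mul_comm]
  rw [op_mul_comm, smul_mulVec, h2, smul_smul] at h1
  have h3 := eigenvalue_unique hψ h1
  have hab : b * a ≠ 0 := by
    have ha := eigenvalue_mul_self hψ hv
    have hb := eigenvalue_mul_self hψ hw
    intro h0
    rcases mul_eq_zero.1 h0 with h0 | h0 <;> simp [h0] at ha hb
  exact (signChar_eq_one_iff _).1 (mul_right_cancel₀ hab (by rw [h3, one_mul]))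

end PauliVec

open PauliVec

variable {n : ℕ}

/-- The exponents of the Pauli operators of which `ψ` is an eigenvector. -/
def stabSpace (ψ : QState n) : Submodule (ZMod 2) (PauliVec n) where
  carrier := {v | ∃ a : ℂ, v.op *ᵥ ψ = a • ψ}
  zero_mem' := ⟨1, by rw [PauliVec.op_zero, one_mulVec, one_smul]⟩
  add_mem' := by
    rintro v w ⟨a, ha⟩ ⟨b, hb⟩
    obtain ⟨c, hc0, hc⟩ := exists_ne_zero_op_mul v w
    exact ⟨_, op_add_mulVec hc0 hc ha hb⟩
  smul_mem' := by
    rintro c v ⟨a, ha⟩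
    rcases zmod_two_cases c with rfl | rfl
    · rw [zero_smul]; exact ⟨1, by rw [PauliVec.op_zero, one_mulVec, one_smul]⟩
    · rw [one_smul]; exact ⟨a, ha⟩

theorem mem_stabSpace {ψ : QState n} {v : PauliVec n} :
    v ∈ stabSpace ψ ↔ ∃ a : ℂ, v.op *ᵥ ψ = a • ψ := Iff.rfl

theorem mem_stabilizerGroup_iff {ψ : QState n} {s : Fin 2} {v : PauliVec n} :
    (s, v.toString) ∈ stabilizerGroup ψ ↔ v.op *ᵥ ψ = (-1 : ℂ) ^ (s : ℕ) • ψ := by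
  simp only [stabilizerGroup, Set.mem_ofPred_eq, smul_mulVec]
  constructor
  · intro h
    conv_rhs => rw [← h]
    rw [smul_smul, sign_mul_self, one_smul]
  · intro h
    rw [h, smul_smul, sign_mul_self, one_smul]

/-- Forgetting the sign is a bijection: eigenvalues of Paulis are `±1`, and the sign must match the
eigenvalue. -/
theorem ncard_stabilizerGroup {ψ : QState n} (hψ : ψ ≠ 0) :
    (stabilizerGroup ψ).ncard = Nat.card (stabSpace ψ) := by
  have himg : (fun g : Fin 2 × PauliString n => (equivString n).symm g.2) '' stabilizerGroup ψ =
      (stabSpace ψ : Set (PauliVec n)) := by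
    ext v
    simp only [Set.mem_image, SetLike.mem_coe, mem_stabSpace]
    constructor
    · rintro ⟨⟨s, P⟩, hg, rfl⟩
      rw [← (equivString n).apply_symm_apply P] at hg
      exact ⟨_, mem_stabilizerGroup_iff.1 hg⟩
    · rintro ⟨a, ha⟩
      obtain ⟨s, hs⟩ := exists_sign (eigenvalue_mul_self hψ ha)
      refine ⟨(s, v.toString), mem_stabilizerGroup_iff.2 (by rw [hs]; exact ha), ?_⟩
      exact (equivString n).symm_apply_apply v
  rw [← SetLike.coe_sort_coe, Nat.card_coe_set_eq, ← himg, Set.InjOn.ncard_image]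
  rintro ⟨s, P⟩ hg ⟨s', P'⟩ hg' h
  have hP : P = P' := (equivString n).symm.injective h
  subst hP
  rw [← (equivString n).apply_symm_apply P] at hg hg'
  have := eigenvalue_unique hψ ((mem_stabilizerGroup_iff.1 hg).symm.trans
    (mem_stabilizerGroup_iff.1 hg'))
  rw [sign_injective this]

theorem stabSpace_le_orthogonal {ψ : QState n} (hψ : ψ ≠ 0) :
    stabSpace ψ ≤ (symp n).orthogonal (stabSpace ψ) := by
  rintro v ⟨a, ha⟩ w ⟨b, hb⟩
  exact symp_eq_zero_of_eigen hψ hb ha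

theorem natCard_eq_two_pow_finrank (E : Type*) [AddCommGroup E] [Module (ZMod 2) E]
    [Module.Finite (ZMod 2) E] : Nat.card E = 2 ^ Module.finrank (ZMod 2) E := by
  rw [Module.natCard_eq_pow_finrank (K := ZMod 2), Nat.card_zmod]

theorem finrank_orthogonal_stabSpace (ψ : QState n) :
    Module.finrank (ZMod 2) ((symp n).orthogonal (stabSpace ψ)) =
      2 * n - Module.finrank (ZMod 2) (stabSpace ψ) := by
  rw [LinearMap.BilinForm.finrank_orthogonal symp_nondegenerate, finrank_eq]

theorem finrank_stabSpace_le {ψ : QState n} (hψ : ψ ≠ 0) :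
    Module.finrank (ZMod 2) (stabSpace ψ) ≤ n := by
  have h1 := Submodule.finrank_mono (stabSpace_le_orthogonal hψ)
  rw [finrank_orthogonal_stabSpace] at h1
  omega

theorem isStabilizerState_iff_finrank {ψ : QState n} (hψ : ψ ≠ 0) :
    IsStabilizerState ψ ↔ Module.finrank (ZMod 2) (stabSpace ψ) = n := by
  rw [IsStabilizerState, ncard_stabilizerGroup hψ, natCard_eq_two_pow_finrank]
  constructor
  · rintro ⟨_, h⟩
    exact Nat.pow_right_injective le_rfl h
  · intro h
    exact ⟨hψ, by rw [h]⟩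

/-- The stabilizer space is isotropic; having half of the dimension `2 * n`, it is Lagrangian. -/
theorem IsStabilizerState.orthogonal_stabSpace {ψ : QState n} (h : IsStabilizerState ψ) :
    (symp n).orthogonal (stabSpace ψ) = stabSpace ψ := by
  symm
  apply Submodule.eq_of_le_of_finrank_eq (stabSpace_le_orthogonal h.1)
  rw [finrank_orthogonal_stabSpace, (isStabilizerState_iff_finrank h.1).1 h]
  omega

theorem QState.ip_smul_left (c : ℂ) (u v : QState n) : ip (c • u) v = star c * ip u v := by
  simp only [ip, Finset.mul_sum, Pi.smul_apply, smul_eq_mul, star_mul']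
  exact Finset.sum_congr rfl fun z _ => by ring

theorem QState.ip_op_comm (v : PauliVec n) (u w : QState n) :
    ip u (v.op *ᵥ w) = ip (v.op *ᵥ u) w := by
  rw [ip_mulVec, PauliString.op_conjTranspose]

theorem star_eq_of_mul_self {a : ℂ} (h : a * a = 1) : star a = a := by
  rcases mul_self_eq_one_iff.1 h with rfl | rfl <;> simp

/-- A stabilizer state is determined by its stabilizer group up to a factor. -/
theorem IsStabilizerState.exists_smul_eq {ψ : QState n} (h : IsStabilizerState ψ) {φ : QState n}
    (hφ : ∀ v : PauliVec n, ∀ a : ℂ, v.op *ᵥ ψ = a • ψ → v.op *ᵥ φ = a • φ) :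
    ∃ c : ℂ, φ = c • ψ := by
  have hn : QState.ip ψ ψ ≠ 0 := by
    rw [QState.ip_self]
    exact_mod_cast fun h0 => h.1 ((QState.sqNorm_eq_zero_iff ψ).1 h0)
  set c := QState.ip ψ φ / QState.ip ψ ψ with hc
  refine ⟨c, ?_⟩
  -- The component of `φ` orthogonal to `ψ` has the same eigenvalues; it vanishes because all its
  -- Pauli translates turn out to be orthogonal to `ψ`.
  set χ : QState n := φ - c • ψ with hχ
  have hχ0 : QState.ip ψ χ = 0 := by
    rw [hχ, QState.ip_sub, QState.ip_smul, hc, div_mul_cancel₀ _ hn, sub_self]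
  have hχs : ∀ v : PauliVec n, ∀ a : ℂ, v.op *ᵥ ψ = a • ψ → v.op *ᵥ χ = a • χ := by
    intro v a ha
    rw [hχ, mulVec_sub, mulVec_smul, hφ v a ha, ha, smul_sub, smul_comm]
  have hz : ∀ b : PauliVec n, QState.ip ψ (b.op *ᵥ χ) = 0 := by
    intro b
    by_cases hb : b ∈ stabSpace ψ
    · obtain ⟨a, ha⟩ := hb
      rw [hχs b a ha, QState.ip_smul, hχ0, mul_zero]
    -- Outside the Lagrangian, `b` anticommutes with some stabilizer `v`; moving `v` to either side
    -- shows that the inner product equals its own negative.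
    · rw [← h.orthogonal_stabSpace, LinearMap.BilinForm.mem_orthogonal_iff] at hb
      push Not at hb
      obtain ⟨v, ⟨a, ha⟩, hvb⟩ := hb
      have hs : symp n v b = 1 := (zmod_two_cases _).resolve_left hvb
      have ha1 := eigenvalue_mul_self h.1 ha
      have e1 : QState.ip ψ (v.op *ᵥ (b.op *ᵥ χ)) = a * QState.ip ψ (b.op *ᵥ χ) := by
        rw [QState.ip_op_comm v, ha, QState.ip_smul_left, star_eq_of_mul_self ha1]
      have e2 : QState.ip ψ (v.op *ᵥ (b.op *ᵥ χ)) = -(a * QState.ip ψ (b.op *ᵥ χ)) := by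
        rw [mulVec_mulVec, op_mul_comm, hs, signChar_one, smul_mulVec, ← mulVec_mulVec,
          hχs v a ha, mulVec_smul, smul_smul, QState.ip_smul]
        ring
      have ha0 : a ≠ 0 := by rintro rfl; simp at ha1
      have : a * QState.ip ψ (b.op *ᵥ χ) = 0 := by
        have := e1.symm.trans e2
        exact self_eq_neg.1 this
      exact (mul_eq_zero.1 this).resolve_left ha0
  rcases QState.eq_zero_of_ip_op_eq_zero hz with h0 | h0
  · exact absurd h0 h.1
  · exact sub_eq_zero.1 h0

/-- The eigenvalue of a sum depends only on those of the summands and on the phase of the operator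
product, which is the same for `ψ` and `φ`. -/
theorem eigen_of_mem_span {ψ φ : QState n} {s : Set (PauliVec n)}
    (hs : ∀ v ∈ s, ∃ a : ℂ, v.op *ᵥ ψ = a • ψ ∧ v.op *ᵥ φ = a • φ) {v : PauliVec n}
    (hv : v ∈ Submodule.span (ZMod 2) s) : ∃ a : ℂ, v.op *ᵥ ψ = a • ψ ∧ v.op *ᵥ φ = a • φ := by
  have h0 : ∃ a : ℂ, (0 : PauliVec n).op *ᵥ ψ = a • ψ ∧ (0 : PauliVec n).op *ᵥ φ = a • φ :=
    ⟨1, by rw [PauliVec.op_zero, one_mulVec, one_smul],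
      by rw [PauliVec.op_zero, one_mulVec, one_smul]⟩
  induction hv using Submodule.span_induction with
  | mem v hv => exact hs v hv
  | zero => exact h0
  | add v w _ _ ihv ihw =>
    obtain ⟨a, ha, ha'⟩ := ihv
    obtain ⟨b, hb, hb'⟩ := ihw
    obtain ⟨c, hc0, hc⟩ := exists_ne_zero_op_mul v w
    exact ⟨_, op_add_mulVec hc0 hc ha hb, op_add_mulVec hc0 hc ha' hb'⟩
  | smul c v _ ih =>
    rcases zmod_two_cases c with rfl | rfl
    · rw [zero_smul]; exact h0
    · rw [one_smul]; exact ih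

theorem IsStabilizerState.span_eq_of_eigen {ψ φ : QState n} (h : IsStabilizerState ψ) (hφ0 : φ ≠ 0)
    (hφ : ∀ v : PauliVec n, ∀ a : ℂ, v.op *ᵥ ψ = a • ψ → v.op *ᵥ φ = a • φ) :
    Submodule.span ℂ {φ} = Submodule.span ℂ {ψ} := by
  obtain ⟨c, rfl⟩ := h.exists_smul_eq hφ
  refine Submodule.span_singleton_smul_eq (IsUnit.mk0 c ?_) ψ
  rintro rfl
  simp at hφ0

/-- A state is recovered from its stabilizer group, a subset of a finite set. Finiteness keeps
`ncard` and the supremum in `maxShared` from being default values. -/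
theorem stabilizerStates_finite (n : ℕ) : (stabilizerStates n).Finite := by
  classical
  have hfin : Finite (Fin 2 × PauliString n) := by
    have := Finite.of_equiv _ (equivString n)
    infer_instance
  let f : Submodule ℂ (QState n) → Set (Fin 2 × PauliString n) := fun W =>
    {g | ∀ ψ ∈ W, ((-1 : ℂ) ^ (g.1 : ℕ) • g.2.op) *ᵥ ψ = ψ}
  have hf : ∀ ψ : QState n, f (Submodule.span ℂ {ψ}) = stabilizerGroup ψ := by
    intro ψ
    ext g
    constructor
    · intro h; exact h ψ (Submodule.mem_span_singleton_self ψ)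
    · intro h φ hφ
      obtain ⟨c, rfl⟩ := Submodule.mem_span_singleton.1 hφ
      rw [mulVec_smul]
      exact congrArg _ h
  refine Set.Finite.of_finite_image (f := f) (Set.toFinite _) ?_
  rintro _ ⟨ψ, hψ, rfl⟩ _ ⟨φ, hφ, rfl⟩ h
  rw [hf, hf] at h
  refine (hψ.span_eq_of_eigen hφ.1 fun v a ha => ?_).symm
  obtain ⟨s, rfl⟩ := exists_sign (eigenvalue_mul_self hψ.1 ha)
  rw [← mem_stabilizerGroup_iff] at ha ⊢
  rwa [← h]

/-! ## Graph states -/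

theorem Pauli.exists_mat_apply (p : ZMod 2 × ZMod 2) : ∃ c : ℂ, ‖c‖ = 1 ∧ ∀ z w : ZMod 2,
    (Pauli.ofBits p).mat z w = if w = z + p.1 then c * signChar (p.2 * z) else 0 := by
  obtain ⟨a, b⟩ := p
  rcases zmod_two_cases a with rfl | rfl <;> rcases zmod_two_cases b with rfl | rfl
  · refine ⟨1, by simp, fun z w => ?_⟩
    rcases zmod_two_cases z with rfl | rfl <;> rcases zmod_two_cases w with rfl | rfl <;>
      simp [Pauli.ofBits, Pauli.mat] <;> rfl
  · refine ⟨1, by simp, fun z w => ?_⟩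
    rcases zmod_two_cases z with rfl | rfl <;> rcases zmod_two_cases w with rfl | rfl <;>
      simp [Pauli.ofBits, Pauli.mat] <;> rfl
  · refine ⟨1, by simp, fun z w => ?_⟩
    rcases zmod_two_cases z with rfl | rfl <;> rcases zmod_two_cases w with rfl | rfl <;>
      simp [Pauli.ofBits, Pauli.mat, show (1 + 1 : ZMod 2) = 0 from rfl] <;> rfl
  · refine ⟨-Complex.I, by simp, fun z w => ?_⟩
    rcases zmod_two_cases z with rfl | rfl <;> rcases zmod_two_cases w with rfl | rfl <;>
      simp [Pauli.ofBits, Pauli.mat, show (1 + 1 : ZMod 2) = 0 from rfl] <;> rfl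

/-- The action of a Pauli operator: a shift, a sign and a global phase. -/
theorem PauliVec.exists_op_mulVec (v : PauliVec n) : ∃ c : ℂ, ‖c‖ = 1 ∧
    ∀ (ψ : (Fin n → ZMod 2) → ℂ) (z : Fin n → ZMod 2),
      ((v.op *ᵥ (ψ : QState n) : QState n) : (Fin n → ZMod 2) → ℂ) z =
        c * signChar (∑ i, (v i).2 * z i) * ψ (z + fun i => (v i).1) := by
  choose c hc hmat using Pauli.exists_mat_apply
  refine ⟨∏ i, c (v i), by rw [norm_prod]; simp [hc], fun ψ z => ?_⟩
  have h1 : ∀ w : Fin n → ZMod 2, v.op z w =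
      if w = (z + fun i => (v i).1) then (∏ i, c (v i)) * signChar (∑ i, (v i).2 * z i) else 0 := by
    intro w
    simp only [PauliVec.op, PauliString.op, PauliVec.toString]
    rw [Finset.prod_congr rfl fun i _ => hmat (v i) (z i) (w i), Finset.prod_ite_zero,
      signChar_sum, ← Finset.prod_mul_distrib]
    simp [funext_iff]
  change ∑ w : Fin n → ZMod 2, v.op z w * ψ w = _
  simp [h1]

/-- The edge exponent of the graph state with adjacency data `S`. -/
def graphForm (S : ∀ i : Fin n, Fin i → ZMod 2) (z : Fin n → ZMod 2) : ZMod 2 :=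
  ∑ i : Fin n, ∑ j : Fin i, S i j * (z i * z (Fin.castLE i.2.le j))

/-- The graph state with adjacency data `S`. -/
noncomputable def graphState (S : ∀ i : Fin n, Fin i → ZMod 2) : QState n :=
  fun z => signChar (graphForm S z)

/-- Polarization of a quadratic form. A shift by `b` thus changes the phases of a graph state only
by a character, which a product of `Z` operators undoes. -/
theorem exists_graphForm_add (S : ∀ i : Fin n, Fin i → ZMod 2) (b : Fin n → ZMod 2) :
    ∃ a : Fin n → ZMod 2, ∀ z, graphForm S (z + b) =
      graphForm S z + graphForm S b + ∑ i, a i * z i := by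
  let f : (Fin n → ZMod 2) →ₗ[ZMod 2] ZMod 2 :=
    { toFun := fun z => ∑ i : Fin n, ∑ j : Fin i, S i j *
        (z i * b (Fin.castLE i.2.le j) + b i * z (Fin.castLE i.2.le j))
      map_add' := by
        intro x y
        simp only [← Finset.sum_add_distrib, Pi.add_apply]
        refine Finset.sum_congr rfl fun i _ => Finset.sum_congr rfl fun j _ => ?_
        ring
      map_smul' := by
        intro c x
        simp only [Finset.mul_sum, Pi.smul_apply, smul_eq_mul, RingHom.id_apply]
        refine Finset.sum_congr rfl fun i _ => Finset.sum_congr rfl fun j _ => ?_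
        ring }
  refine ⟨fun i => f (fun j => if i = j then 1 else 0), fun z => ?_⟩
  have h1 := LinearMap.pi_apply_eq_sum_univ f z
  have h2 : graphForm S (z + b) = graphForm S z + graphForm S b + f z := by
    simp only [graphForm, f, LinearMap.coe_mk, AddHom.coe_mk, ← Finset.sum_add_distrib,
      Pi.add_apply]
    refine Finset.sum_congr rfl fun i _ => Finset.sum_congr rfl fun j _ => ?_
    ring
  rw [h2, h1]
  congr 1
  exact Finset.sum_congr rfl fun i _ => by rw [smul_eq_mul, mul_comm]

theorem signChar_ne_zero (a : ZMod 2) : signChar a ≠ 0 := by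
  rcases zmod_two_cases a with rfl | rfl <;> simp

theorem graphState_ne_zero (S : ∀ i : Fin n, Fin i → ZMod 2) : graphState S ≠ 0 := fun h =>
  signChar_ne_zero _ (congrFun h (fun _ => 0))

theorem isStabilizerState_graphState (S : ∀ i : Fin n, Fin i → ZMod 2) :
    IsStabilizerState (graphState S) := by
  rw [isStabilizerState_iff_finrank (graphState_ne_zero S)]
  refine le_antisymm (finrank_stabSpace_le (graphState_ne_zero S)) ?_
  -- Each of the `2 ^ n` possible X parts `b` occurs in a stabilizer, its Z part being the linear
  -- form of the polarization.
  have hmem : ∀ b : Fin n → ZMod 2, ∃ v ∈ stabSpace (graphState S), (fun i => (v i).1) = b := by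
    intro b
    obtain ⟨a, ha⟩ := exists_graphForm_add S b
    refine ⟨fun i => (b i, a i), ?_, rfl⟩
    obtain ⟨c, -, hc⟩ := PauliVec.exists_op_mulVec (fun i => (b i, a i) : PauliVec n)
    refine ⟨c * signChar (graphForm S b), ?_⟩
    have h1 : ∀ z : Fin n → ZMod 2,
        c * signChar (∑ i, a i * z i) * signChar (graphForm S (z + b)) =
          c * signChar (graphForm S b) * signChar (graphForm S z) := ?_
    · exact funext fun z => (hc (graphState S) z).trans (h1 z)
    intro z
    rw [ha z, signChar_add, signChar_add]
    have h2 : signChar (∑ i, a i * z i) * signChar (∑ i, a i * z i) = 1 := by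
      generalize (∑ i, a i * z i : ZMod 2) = t
      rcases zmod_two_cases t with rfl | rfl <;> simp
    linear_combination (c * signChar (graphForm S b) * signChar (graphForm S z)) * h2
  choose v hv hvb using hmem
  have hcard : Nat.card (Fin n → ZMod 2) ≤ Nat.card (stabSpace (graphState S)) := by
    refine Nat.card_le_card_of_injective (fun b => ⟨v b, hv b⟩) fun b b' h => ?_
    have h' : v b = v b' := congrArg Subtype.val h
    rw [← hvb b, ← hvb b', h']
  rw [natCard_eq_two_pow_finrank, natCard_eq_two_pow_finrank, Module.finrank_fin_fun] at hcard
  exact (Nat.pow_le_pow_iff_right (by norm_num)).1 hcard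

theorem graphState_span_injective :
    Function.Injective fun S : ∀ i : Fin n, Fin i → ZMod 2 => Submodule.span ℂ {graphState S} := by
  intro S S' h
  have hmem : graphState S ∈ Submodule.span ℂ {graphState S'} := by
    rw [← show Submodule.span ℂ {graphState S} = Submodule.span ℂ {graphState S'} from h]
    exact Submodule.mem_span_singleton_self _
  obtain ⟨c, hc⟩ := Submodule.mem_span_singleton.1 hmem
  have h0 : ∀ S : ∀ i : Fin n, Fin i → ZMod 2, graphForm S 0 = 0 := by intro S; simp [graphForm]
  -- Both graph states have amplitude 1 at `z = 0`.
  have hc1 : c = 1 := by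
    have := congrFun hc (0 : Fin n → ZMod 2)
    change c * signChar (graphForm S' 0) = signChar (graphForm S 0) at this
    simpa [h0] using this
  subst hc1
  rw [one_smul] at hc
  have hq : ∀ z, graphForm S' z = graphForm S z := by
    intro z
    have h1 : signChar (graphForm S' z) = signChar (graphForm S z) := congrFun hc z
    rcases zmod_two_cases (graphForm S' z) with h2 | h2 <;>
      rcases zmod_two_cases (graphForm S z) with h3 | h3 <;> rw [h2, h3] at h1 ⊢ <;>
      norm_num at h1
  -- The form has no diagonal terms, so on a sum of two basis vectors only the edge between them
  -- contributes.
  have hS : ∀ (S : ∀ i : Fin n, Fin i → ZMod 2) (i : Fin n) (j : Fin i),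
      graphForm S (Pi.single i 1 + Pi.single (Fin.castLE i.2.le j) 1) = S i j := by
    intro S i j
    have hne : Fin.castLE i.2.le j ≠ i := fun h => by
      have := congrArg Fin.val h
      simp at this
      omega
    rw [graphForm, Finset.sum_eq_single i, Finset.sum_eq_single j]
    · simp [hne, hne.symm]
    · intro j' _ hj'
      have h1 : Fin.castLE i.2.le j' ≠ i := fun h => by
        have := congrArg Fin.val h
        simp at this
        omega
      have h2 : Fin.castLE i.2.le j' ≠ Fin.castLE i.2.le j := fun h =>
        hj' (Fin.castLE_injective _ h)
      simp [h1, h2]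
    · simp
    · intro i' _ hi'
      refine Finset.sum_eq_zero fun j' _ => ?_
      by_cases h1 : i' = Fin.castLE i.2.le j
      · have h2 : Fin.castLE i'.2.le j' ≠ i := fun h => by
          have := congrArg Fin.val h
          have h3 := congrArg Fin.val h1
          simp at this h3
          omega
        have h3 : Fin.castLE i'.2.le j' ≠ Fin.castLE i.2.le j := fun h => by
          have := congrArg Fin.val h
          have h3 := congrArg Fin.val h1
          simp at this h3
          omega
        simp [h2, h3]
      · simp [hi', h1]
    · simp
  funext i j
  rw [← hS S i j, ← hS S' i j, hq]

theorem two_pow_le_ncard_stabilizerStates (n : ℕ) :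
    2 ^ (n * (n - 1) / 2) ≤ (stabilizerStates n).ncard := by
  have h1 : Nat.card (∀ i : Fin n, Fin i → ZMod 2) = 2 ^ (n * (n - 1) / 2) := by
    rw [Nat.card_eq_fintype_card, Fintype.card_pi]
    simp only [Fintype.card_pi, ZMod.card, Finset.prod_const, Finset.card_univ, Fintype.card_fin]
    rw [Finset.prod_pow_eq_pow_sum, Fin.sum_univ_eq_sum_range (fun i => i), Finset.sum_range_id]
  rw [← h1, ← Set.ncard_univ, ← Set.ncard_image_of_injective _ graphState_span_injective]
  refine Set.ncard_le_ncard ?_ (stabilizerStates_finite n)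
  rintro _ ⟨S, -, rfl⟩
  exact ⟨_, isStabilizerState_graphState S, rfl⟩

/-! ## Families of Lagrangian subspaces with consistent signs -/

namespace PauliVec

variable {n : ℕ}

theorem mem_of_forall_symp {L : Submodule (ZMod 2) (PauliVec n)} (hL : (symp n).orthogonal L = L)
    {v : PauliVec n} (h : ∀ w ∈ L, symp n w v = 0) : v ∈ L := by
  rw [← hL, LinearMap.BilinForm.mem_orthogonal_iff]; exact h

theorem symp_eq_zero_of_mem {L : Submodule (ZMod 2) (PauliVec n)}
    (hL : (symp n).orthogonal L = L) {v w : PauliVec n} (hv : v ∈ L) (hw : w ∈ L) :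
    symp n v w = 0 := by
  rw [← hL, LinearMap.BilinForm.mem_orthogonal_iff] at hw; exact hw v hv

/-- Taking orthogonal complements exchanges sums and intersections and fixes each Lagrangian. -/
theorem le_sup_of_inf_le {L₁ L₂ L₃ : Submodule (ZMod 2) (PauliVec n)}
    (h₁ : (symp n).orthogonal L₁ = L₁) (h₂ : (symp n).orthogonal L₂ = L₂)
    (h₃ : (symp n).orthogonal L₃ = L₃) (h : L₁ ⊓ L₂ ≤ L₃) : L₃ ≤ L₁ ⊔ L₂ := by
  rw [← LinearMap.BilinForm.orthogonal_orthogonal symp_nondegenerate symp_isRefl (L₁ ⊔ L₂),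
    ← h₃]
  refine LinearMap.BilinForm.orthogonal_le (le_trans ?_ h)
  refine le_inf ?_ ?_
  · conv_rhs => rw [← h₁]
    exact LinearMap.BilinForm.orthogonal_le le_sup_left
  · conv_rhs => rw [← h₂]
    exact LinearMap.BilinForm.orthogonal_le le_sup_right

/-- A consistent choice `S` of signed Pauli operators: it is multiplicative on commuting pairs
of elements of `U`. -/
structure ConsistentSigns (U : Set (PauliVec n))
    (S : PauliVec n → Matrix (Fin n → Fin 2) (Fin n → Fin 2) ℂ) : Prop where
  signed : ∀ v, ∃ ε : ℂ, ε * ε = 1 ∧ S v = ε • v.op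
  mul : ∀ v ∈ U, ∀ w ∈ U, symp n v w = 0 → S v * S w = S (v + w)

namespace ConsistentSigns

variable {U : Set (PauliVec n)} {S : PauliVec n → Matrix (Fin n → Fin 2) (Fin n → Fin 2) ℂ}

theorem mul_self (hS : ConsistentSigns U S) (v : PauliVec n) : S v * S v = 1 := by
  obtain ⟨ε, hε, h⟩ := hS.signed v
  rw [h, smul_mul_smul_comm, hε, PauliString.op_mul_self, one_smul]

theorem symp_eq_zero_of_commute (hS : ConsistentSigns U S) {v w : PauliVec n}
    (h : S v * S w = S w * S v) : symp n v w = 0 := by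
  obtain ⟨ε, hε, hv⟩ := hS.signed v
  obtain ⟨δ, hδ, hw⟩ := hS.signed w
  rw [hv, hw, smul_mul_smul_comm, smul_mul_smul_comm, op_mul_comm v w, smul_smul] at h
  have h1 := congrArg (fun M => M * (v.op * w.op)) h
  simp only [smul_mul_assoc] at h1
  have h2 : w.op * v.op * (v.op * w.op) = 1 := by
    rw [Matrix.mul_assoc, ← Matrix.mul_assoc v.op, PauliString.op_mul_self, Matrix.one_mul,
      PauliString.op_mul_self]
  rw [h2] at h1
  have h3 := congrFun (congrFun h1 0) 0
  simp only [Matrix.smul_apply, Matrix.one_apply_eq, smul_eq_mul, mul_one] at h3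
  have hne : ε * δ ≠ 0 := by
    intro h0
    rcases mul_eq_zero.1 h0 with h0 | h0 <;> simp [h0] at hε hδ
  rw [mul_comm δ ε] at h3
  exact (signChar_eq_one_iff _).1 (mul_left_cancel₀ hne (by rw [h3, mul_one]))

/-- The signs force Lagrangian subspaces that meet a third one in the same subspace to be almost
equal. -/
theorem exists_near (hS : ConsistentSigns U S) {L₁ L₂ L₃ : Submodule (ZMod 2) (PauliVec n)}
    (h₁ : (symp n).orthogonal L₁ = L₁) (h₂ : (symp n).orthogonal L₂ = L₂)
    (h₃ : (symp n).orthogonal L₃ = L₃) (hU₁ : (L₁ : Set (PauliVec n)) ⊆ U)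
    (hU₂ : (L₂ : Set (PauliVec n)) ⊆ U) (hU₃ : (L₃ : Set (PauliVec n)) ⊆ U)
    (hJ : L₁ ⊓ L₂ = L₁ ⊓ L₃) :
    ∃ u ∈ L₃, ∃ v ∈ L₃, ∀ Q ∈ L₃, Q ∈ L₂ ∨ Q + u ∈ L₂ ∨ Q + v ∈ L₂ ∨ Q + (u + v) ∈ L₂ := by
  have hJ₂ : ∀ {x}, x ∈ L₁ → x ∈ L₃ → x ∈ L₂ := fun {x} hx1 hx3 =>
    (show x ∈ L₁ ⊓ L₂ by rw [hJ]; exact ⟨hx1, hx3⟩).2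
  have hdec : ∀ Q ∈ L₃, ∃ a ∈ L₁, ∃ b ∈ L₂, a + b = Q := fun Q hQ =>
    Submodule.mem_sup.1 (le_sup_of_inf_le h₁ h₂ h₃ (hJ.le.trans inf_le_right) hQ)
  choose! a ha b hb hab using hdec
  -- the decomposition of a sum
  have hcross : ∀ Q ∈ L₃, ∀ Q' ∈ L₃, symp n (a Q) (b Q') = symp n (b Q) (a Q') := by
    intro Q hQ Q' hQ'
    have h := symp_eq_zero_of_mem h₃ hQ hQ'
    rw [← hab Q hQ, ← hab Q' hQ'] at h
    simp only [map_add, LinearMap.add_apply] at h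
    rw [symp_eq_zero_of_mem h₁ (ha Q hQ) (ha Q' hQ'),
      symp_eq_zero_of_mem h₂ (hb Q hQ) (hb Q' hQ'), zero_add, add_zero] at h
    have : ∀ x y : ZMod 2, x + y = 0 → y = x := by decide
    exact this _ _ h
  -- The Mermin square, with rows `a Q, b Q, Q` and `a Q', b Q', Q'` and their sum. Expanding `S (Q
  -- + Q')` along rows and along columns and cancelling the outer factors, `S (b Q)` and `S (a Q')`
  -- must commute. This is the only use of the signs.
  have hortho : ∀ Q ∈ L₃, ∀ Q' ∈ L₃, symp n (a Q) (b Q) = 0 → symp n (a Q') (b Q') = 0 →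
      symp n (a Q) Q' = 0 := by
    intro Q hQ Q' hQ' hq hq'
    have hA := ha Q hQ; have hB := hb Q hQ; have hA' := ha Q' hQ'; have hB' := hb Q' hQ'
    have e1 : S Q = S (a Q) * S (b Q) := by
      rw [hS.mul _ (hU₁ hA) _ (hU₂ hB) hq, hab Q hQ]
    have e2 : S Q' = S (a Q') * S (b Q') := by
      rw [hS.mul _ (hU₁ hA') _ (hU₂ hB') hq', hab Q' hQ']
    have e3 : S Q * S Q' = S (Q + Q') :=
      hS.mul _ (hU₃ hQ) _ (hU₃ hQ') (symp_eq_zero_of_mem h₃ hQ hQ')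
    have hs : symp n (a Q + a Q') (b Q + b Q') = 0 := by
      simp only [map_add, LinearMap.add_apply]
      rw [hq, hq', hcross Q hQ Q' hQ', symp_comm (a Q') (b Q)]
      have : ∀ x : ZMod 2, 0 + x + (x + 0) = 0 := by decide
      exact this _
    have e4 : S (Q + Q') = S (a Q) * S (a Q') * (S (b Q) * S (b Q')) := by
      rw [hS.mul _ (hU₁ hA) _ (hU₁ hA') (symp_eq_zero_of_mem h₁ hA hA'),
        hS.mul _ (hU₂ hB) _ (hU₂ hB') (symp_eq_zero_of_mem h₂ hB hB'),
        hS.mul _ (hU₁ (L₁.add_mem hA hA')) _ (hU₂ (L₂.add_mem hB hB')) hs]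
      congr 1
      conv_lhs => rw [← hab Q hQ, ← hab Q' hQ']
      exact add_add_add_comm _ _ _ _
    rw [← e3, e1, e2] at e4
    have e5 : S (b Q) * S (a Q') = S (a Q') * S (b Q) := by
      have h := congrArg (fun M => S (a Q) * M * S (b Q')) e4
      simp only [Matrix.mul_assoc, hS.mul_self, Matrix.mul_one] at h
      simpa only [← Matrix.mul_assoc, hS.mul_self, Matrix.one_mul] using h
    have e6 := hS.symp_eq_zero_of_commute e5
    rw [← hab Q' hQ', map_add, symp_eq_zero_of_mem h₁ hA hA', zero_add, hcross Q hQ Q' hQ', e6]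
  -- The chosen `a` and `b` need not be additive, but their defect lies in `L₁ ⊓ L₂`, which is
  -- orthogonal to both spaces. So `Q ↦ symp n (a Q) (b Q)` is linear on `L₃`.
  have hq_add : ∀ Q ∈ L₃, ∀ Q' ∈ L₃, symp n (a (Q + Q')) (b (Q + Q')) =
      symp n (a Q) (b Q) + symp n (a Q') (b Q') := by
    intro Q hQ Q' hQ'
    have hQQ := L₃.add_mem hQ hQ'
    set A := a Q + a Q' with hA
    set B := b Q + b Q' with hB
    have hAm : A ∈ L₁ := L₁.add_mem (ha Q hQ) (ha Q' hQ')
    have hBm : B ∈ L₂ := L₂.add_mem (hb Q hQ) (hb Q' hQ')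
    have hABeq : A + B = a (Q + Q') + b (Q + Q') := by
      rw [hab _ hQQ, hA, hB, add_add_add_comm, hab Q hQ, hab Q' hQ']
    have hj : A + a (Q + Q') = B + b (Q + Q') := by
      have h := congrArg (fun x => x + a (Q + Q') + B) hABeq
      have e1 : A + B + a (Q + Q') + B = A + a (Q + Q') + (B + B) := by abel
      have e2 : a (Q + Q') + b (Q + Q') + a (Q + Q') + B =
        (a (Q + Q') + a (Q + Q')) + (B + b (Q + Q')) := by abel
      simp only [e1, e2, add_self_zero, zero_add, add_zero] at h
      exact h
    have hjm1 : A + a (Q + Q') ∈ L₁ := L₁.add_mem hAm (ha _ hQQ)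
    have hjm2 : A + a (Q + Q') ∈ L₂ := by rw [hj]; exact L₂.add_mem hBm (hb _ hQQ)
    have e1 : symp n (A + a (Q + Q')) (b (Q + Q')) = 0 := symp_eq_zero_of_mem h₂ hjm2 (hb _ hQQ)
    have e2 : symp n A (B + b (Q + Q')) = 0 := by
      rw [← hj]; exact symp_eq_zero_of_mem h₁ hAm hjm1
    rw [map_add, LinearMap.add_apply] at e1
    rw [map_add] at e2
    have e3 : symp n A B = symp n (a Q) (b Q) + symp n (a Q') (b Q') := by
      rw [hA, hB]
      simp only [map_add, LinearMap.add_apply]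
      rw [hcross Q hQ Q' hQ', symp_comm (a Q') (b Q)]
      have : ∀ x y z : ZMod 2, x + z + (z + y) = x + y := by decide
      exact this _ _ _
    rw [← e3]
    have : ∀ x y z : ZMod 2, x + y = 0 → z + x = 0 → y = z := by decide
    exact this _ _ _ e1 e2
  -- The kernel of this linear form has index at most 2; `u` represents the other coset, or is 0 if
  -- the form vanishes.
  have key : ∃ u ∈ L₃, (∀ Q ∈ L₃, symp n (a Q) (b Q) = 0 ∨
      symp n (a (Q + u)) (b (Q + u)) = 0) ∧
      ∀ Q ∈ L₃, symp n (a Q) (b Q) = 0 → symp n (a Q) u = 0 → Q ∈ L₂ := by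
    have hmem : ∀ u ∈ L₃, (∀ Q ∈ L₃, symp n (a Q) (b Q) = 0 ∨
        symp n (a (Q + u)) (b (Q + u)) = 0) → ∀ Q ∈ L₃, symp n (a Q) (b Q) = 0 →
        symp n (a Q) u = 0 → Q ∈ L₂ := by
      intro u hu hcov Q hQ hq hqu
      -- `a Q` is orthogonal to the kernel by `hortho` and to `u` by assumption, hence to all of
      -- `L₃`. Then it lies in `L₁ ⊓ L₃`, so in `L₂`.
      have haL3 : a Q ∈ L₃ := by
        refine mem_of_forall_symp h₃ fun R hR => ?_
        rw [symp_comm]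
        rcases hcov R hR with hr | hr
        · exact hortho Q hQ R hR hq hr
        · have := hortho Q hQ _ (L₃.add_mem hR hu) hq hr
          rwa [map_add, hqu, add_zero] at this
      rw [← hab Q hQ]
      exact L₂.add_mem (hJ₂ (ha Q hQ) haL3) (hb Q hQ)
    by_cases hex : ∃ u ∈ L₃, symp n (a u) (b u) = 1
    · obtain ⟨u, hu, hu1⟩ := hex
      have hcov : ∀ Q ∈ L₃, symp n (a Q) (b Q) = 0 ∨
          symp n (a (Q + u)) (b (Q + u)) = 0 := by
        intro Q hQ
        rcases zmod_two_cases (symp n (a Q) (b Q)) with h | h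
        · exact .inl h
        · refine .inr ?_
          rw [hq_add Q hQ u hu, h, hu1]; rfl
      exact ⟨u, hu, hcov, hmem u hu hcov⟩
    · push Not at hex
      have hcov : ∀ Q ∈ L₃, symp n (a Q) (b Q) = 0 ∨
          symp n (a (Q + 0)) (b (Q + 0)) = 0 := fun Q hQ =>
        .inl ((zmod_two_cases _).resolve_right (hex Q hQ))
      exact ⟨0, L₃.zero_mem, hcov, hmem 0 L₃.zero_mem hcov⟩
  obtain ⟨u, hu, hcov, hmem⟩ := key
  -- Inside the kernel the only remaining obstruction to lying in `L₂` is the bit `symp n (a Q) u`;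
  -- two elements for which it equals 1 cancel, which costs a second factor of 2 in the index.
  have hv : ∃ v ∈ L₃, ∀ Q ∈ L₃, symp n (a Q) (b Q) = 0 → Q ∈ L₂ ∨ Q + v ∈ L₂ := by
    by_cases hex : ∃ v ∈ L₃, symp n (a v) (b v) = 0 ∧ v ∉ L₂
    · obtain ⟨v, hv, hv0, hvL⟩ := hex
      refine ⟨v, hv, fun Q hQ hq => ?_⟩
      by_contra hcon
      push Not at hcon
      have h1 : symp n (a v) u = 1 :=
        (zmod_two_cases _).resolve_left fun h => hvL (hmem v hv hv0 h)
      have h2 : symp n (a Q) u = 1 :=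
        (zmod_two_cases _).resolve_left fun h => hcon.1 (hmem Q hQ hq h)
      have haL3 : a Q + a v ∈ L₃ := by
        refine mem_of_forall_symp h₃ fun R hR => ?_
        rw [symp_comm, map_add, LinearMap.add_apply]
        rcases hcov R hR with hr | hr
        · rw [hortho Q hQ R hR hq hr, hortho v hv R hR hv0 hr, add_zero]
        · have e1 := hortho Q hQ _ (L₃.add_mem hR hu) hq hr
          have e2 := hortho v hv _ (L₃.add_mem hR hu) hv0 hr
          rw [map_add, h2] at e1
          rw [map_add, h1] at e2
          have : ∀ x y : ZMod 2, x + 1 = 0 → y + 1 = 0 → x + y = 0 := by decide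
          exact this _ _ e1 e2
      apply hcon.2
      rw [← hab Q hQ, ← hab v hv, add_add_add_comm]
      exact L₂.add_mem (hJ₂ (L₁.add_mem (ha Q hQ) (ha v hv)) haL3)
        (L₂.add_mem (hb Q hQ) (hb v hv))
    · push Not at hex
      exact ⟨0, L₃.zero_mem, fun Q hQ hq => .inl (hex Q hQ hq)⟩
  obtain ⟨v, hv, hvQ⟩ := hv
  refine ⟨u, hu, v, hv, fun Q hQ => ?_⟩
  rcases hcov Q hQ with h | h
  · rcases hvQ Q hQ h with h | h
    · exact .inl h
    · exact .inr (.inr (.inl h))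
  · rcases hvQ _ (L₃.add_mem hQ hu) h with h | h
    · exact .inr (.inl h)
    · exact .inr (.inr (.inr (by rwa [← add_assoc])))

end ConsistentSigns

/-- The Lagrangian subspace that is generated by `u`, `v` and the elements of `L` that are
orthogonal to `u` and `v`, as a set. -/
def neighbour (L : Submodule (ZMod 2) (PauliVec n)) (u v : PauliVec n) : Set (PauliVec n) :=
  {Q | ∃ e : PauliVec n, (e = 0 ∨ e = u ∨ e = v ∨ e = u + v) ∧ Q + e ∈ L ∧
    symp n (Q + e) u = 0 ∧ symp n (Q + e) v = 0}

/-- The right-hand side mentions only `L`, `u` and `v`, so given `L` there are at most `(4 ^ n) ^ 2`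
such `L'`. For the inclusion of `neighbour L u v` in `L'`, `Q + e` is orthogonal to `u`, `v` and to
the part of `L'` in `L`, so to `L'`. -/
theorem eq_neighbour {L L' : Submodule (ZMod 2) (PauliVec n)}
    (h : (symp n).orthogonal L = L) (h' : (symp n).orthogonal L' = L') {u v : PauliVec n}
    (hu : u ∈ L') (hv : v ∈ L')
    (huv : ∀ Q ∈ L', Q ∈ L ∨ Q + u ∈ L ∨ Q + v ∈ L ∨ Q + (u + v) ∈ L) :
    (L' : Set (PauliVec n)) = neighbour L u v := by
  have hcov : ∀ Q ∈ L', ∃ e ∈ L', (e = 0 ∨ e = u ∨ e = v ∨ e = u + v) ∧ Q + e ∈ L := by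
    intro Q hQ
    rcases huv Q hQ with h | h | h | h
    · exact ⟨0, L'.zero_mem, .inl rfl, by rwa [add_zero]⟩
    · exact ⟨u, hu, .inr (.inl rfl), h⟩
    · exact ⟨v, hv, .inr (.inr (.inl rfl)), h⟩
    · exact ⟨u + v, L'.add_mem hu hv, .inr (.inr (.inr rfl)), h⟩
  have hsymp : ∀ R e : PauliVec n, (e = 0 ∨ e = u ∨ e = v ∨ e = u + v) → symp n R u = 0 →
      symp n R v = 0 → symp n R e = 0 := by
    rintro R e (rfl | rfl | rfl | rfl) h1 h2 <;> simp [h1, h2]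
  ext Q
  constructor
  · intro hQ
    obtain ⟨e, heL, he, hQe⟩ := hcov Q hQ
    exact ⟨e, he, hQe, symp_eq_zero_of_mem h' (L'.add_mem hQ heL) hu,
      symp_eq_zero_of_mem h' (L'.add_mem hQ heL) hv⟩
  · rintro ⟨e, he, hQe, h1, h2⟩
    have heL : e ∈ L' := by
      rcases he with rfl | rfl | rfl | rfl
      exacts [L'.zero_mem, hu, hv, L'.add_mem hu hv]
    have hmem : Q + e ∈ L' := by
      refine mem_of_forall_symp h' fun R hR => ?_
      obtain ⟨f, hf, hfe, hRf⟩ := hcov R hR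
      have e1 : symp n R (Q + e) + symp n f (Q + e) = 0 := by
        rw [← LinearMap.add_apply, ← map_add]
        exact symp_eq_zero_of_mem h hRf hQe
      rw [symp_comm f, hsymp _ f hfe h1 h2, add_zero] at e1
      exact e1
    have := L'.add_mem hmem heL
    rwa [add_assoc, add_self_zero, add_zero] at this

end PauliVec

/-! ## The number of subspaces -/

theorem two_pow_le_prod_sub (j : ℕ) : 2 ^ (j * (j - 1)) ≤ ∏ i : Fin j, (2 ^ j - 2 ^ (i : ℕ)) := by
  calc 2 ^ (j * (j - 1)) = ∏ _i : Fin j, 2 ^ (j - 1) := by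
        rw [Finset.prod_const, Finset.card_univ, Fintype.card_fin, ← pow_mul, mul_comm]
    _ ≤ _ := by
        refine Finset.prod_le_prod' fun i _ => ?_
        have hi := i.2
        have h1 : 2 ^ (i : ℕ) ≤ 2 ^ (j - 1) := Nat.pow_le_pow_right (by norm_num) (by omega)
        have h2 : 2 ^ j = 2 * 2 ^ (j - 1) := by
          rw [← pow_succ']; congr 1; omega
        omega

/-- Double counting of bases: each `j`-dimensional subspace has at least `2 ^ (j * (j - 1))` ordered
bases, and a `j`-tuple of vectors of `E` is a basis of only one subspace, its span. -/
theorem card_submodule_finrank_eq_le (E : Type) [AddCommGroup E] [Module (ZMod 2) E] [Finite E]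
    (j : ℕ) :
    Nat.card {J : Submodule (ZMod 2) E // Module.finrank (ZMod 2) J = j} * 2 ^ (j * (j - 1)) ≤
      2 ^ (Module.finrank (ZMod 2) E * j) := by
  classical
  have := Fintype.ofFinite E
  have hcard : ∀ J : {J : Submodule (ZMod 2) E // Module.finrank (ZMod 2) J = j},
      2 ^ (j * (j - 1)) ≤ Nat.card {s : Fin j → J.1 // LinearIndependent (ZMod 2) s} := by
    rintro ⟨J, hJ⟩
    rw [card_linearIndependent (K := ZMod 2) (V := J) hJ.ge]
    simpa [hJ] using two_pow_le_prod_sub j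
  have h1 : Nat.card (Σ J : {J : Submodule (ZMod 2) E // Module.finrank (ZMod 2) J = j},
      {s : Fin j → J.1 // LinearIndependent (ZMod 2) s}) ≤ Nat.card (Fin j → E) := by
    refine Nat.card_le_card_of_injective (fun x i => ((x.2.1 i : x.1.1) : E)) ?_
    have hspan : ∀ x : Σ J : {J : Submodule (ZMod 2) E // Module.finrank (ZMod 2) J = j},
        {s : Fin j → J.1 // LinearIndependent (ZMod 2) s},
        x.1.1 = Submodule.span (ZMod 2) (Set.range fun i => ((x.2.1 i : x.1.1) : E)) := by
      rintro ⟨⟨J, hJ⟩, s, hs⟩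
      have h2 := hs.span_eq_top_of_card_eq_finrank' (by rw [Fintype.card_fin, hJ])
      have h3 := congrArg (Submodule.map J.subtype) h2
      rw [Submodule.map_span, Submodule.map_top, Submodule.range_subtype, ← Set.range_comp] at h3
      exact h3.symm
    rintro x y hxy
    have hJ : x.1 = y.1 := by
      apply Subtype.ext
      rw [hspan x, hspan y]
      simp only at hxy
      rw [hxy]
    obtain ⟨J, s, hs⟩ := x
    obtain ⟨J', s', hs'⟩ := y
    simp only at hJ
    subst hJ
    have : s = s' := by
      funext i
      exact Subtype.ext (congrFun hxy i)
    subst this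
    rfl
  rw [Nat.card_sigma, Nat.card_fun, natCard_eq_two_pow_finrank, ← pow_mul, Nat.card_eq_fintype_card,
    Fintype.card_fin] at h1
  refine le_trans ?_ h1
  rw [Nat.card_eq_fintype_card, ← Finset.card_univ, ← smul_eq_mul, ← Finset.sum_const]
  exact Finset.sum_le_sum fun J _ => hcard J

theorem card_submodule_le (E : Type) [AddCommGroup E] [Module (ZMod 2) E] [Finite E] {n : ℕ}
    (hn : Module.finrank (ZMod 2) E = n) :
    Nat.card (Submodule (ZMod 2) E) ≤ 2 ^ (n ^ 2 / 4 + 2 * n) := by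
  classical
  have hj : ∀ j ≤ n, Nat.card {J : Submodule (ZMod 2) E // Module.finrank (ZMod 2) J = j} ≤
      2 ^ (n ^ 2 / 4 + n) := by
    intro j hjn
    have h1 := card_submodule_finrank_eq_le E j
    rw [hn] at h1
    -- The difference `n j - j (j - 1)` is `j (n - j) + j`, and `j (n - j)` is at most `n² / 4`.
    have h2 : n * j ≤ n ^ 2 / 4 + n + j * (j - 1) := by
      obtain ⟨d, rfl⟩ := Nat.exists_eq_add_of_le hjn
      have h3 : j * d ≤ (j + d) ^ 2 / 4 := by
        rw [Nat.le_div_iff_mul_le (by norm_num)]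
        zify
        nlinarith [sq_nonneg ((j : ℤ) - d)]
      have h4 : j * j ≤ j * (j - 1) + j := by
        cases j with
        | zero => simp
        | succ j => simp; ring_nf; omega
      nlinarith
    have h3 : Nat.card {J : Submodule (ZMod 2) E // Module.finrank (ZMod 2) J = j} *
        2 ^ (j * (j - 1)) ≤ 2 ^ (n ^ 2 / 4 + n) * 2 ^ (j * (j - 1)) := by
      rw [← pow_add]
      exact h1.trans (Nat.pow_le_pow_right (by norm_num) h2)
    exact Nat.le_of_mul_le_mul_right h3 (by positivity)
  have hfin : Finite (Submodule (ZMod 2) E) := inferInstance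
  have := Fintype.ofFinite (Submodule (ZMod 2) E)
  have h1 : Nat.card (Submodule (ZMod 2) E) ≤ (n + 1) * 2 ^ (n ^ 2 / 4 + n) := by
    rw [Nat.card_eq_fintype_card, ← Finset.card_univ]
    have := Finset.card_le_mul_card_image_of_maps_to
      (s := (Finset.univ : Finset (Submodule (ZMod 2) E))) (t := Finset.range (n + 1))
      (f := fun J : Submodule (ZMod 2) E => Module.finrank (ZMod 2) J) (fun J _ => by
        have := Submodule.finrank_le J
        rw [hn] at this
        simpa [Nat.lt_succ_iff] using this) (2 ^ (n ^ 2 / 4 + n)) (fun j hjm => by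
        have := hj j (by simpa [Nat.lt_succ_iff] using hjm)
        rwa [Nat.card_eq_fintype_card, Fintype.card_subtype] at this)
    rw [Finset.card_range, mul_comm] at this
    exact this
  refine h1.trans ?_
  have h2 : n + 1 ≤ 2 ^ n := Nat.lt_two_pow_self
  calc (n + 1) * 2 ^ (n ^ 2 / 4 + n) ≤ 2 ^ n * 2 ^ (n ^ 2 / 4 + n) := Nat.mul_le_mul_right _ h2
    _ = 2 ^ (n ^ 2 / 4 + 2 * n) := by rw [← pow_add]; congr 1; ring

namespace PauliVec

variable {n : ℕ}

theorem finrank_eq_of_orthogonal {L : Submodule (ZMod 2) (PauliVec n)}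
    (h : (symp n).orthogonal L = L) : Module.finrank (ZMod 2) L = n := by
  have h1 := LinearMap.BilinForm.finrank_orthogonal symp_nondegenerate L
  have h2 := Submodule.finrank_le L
  rw [h, finrank_eq] at h1
  rw [finrank_eq] at h2
  omega

theorem card_eq : Fintype.card (PauliVec n) = 4 ^ n := by
  simp [PauliVec]

/-- There are at most `2 ^ (n² / 4 + O(n))` Lagrangian subspaces with consistent signs. -/
theorem ConsistentSigns.card_le {U : Set (PauliVec n)}
    {S : PauliVec n → Matrix (Fin n → Fin 2) (Fin n → Fin 2) ℂ} (hS : ConsistentSigns U S)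
    (F : Finset (Submodule (ZMod 2) (PauliVec n))) (hF : ∀ L ∈ F, (symp n).orthogonal L = L)
    (hU : ∀ L ∈ F, (L : Set (PauliVec n)) ⊆ U) : F.card ≤ 2 ^ (n ^ 2 / 4 + 6 * n) := by
  classical
  rcases F.eq_empty_or_nonempty with rfl | ⟨L₁, hL₁⟩
  · simp
  have := Fintype.ofFinite (Submodule (ZMod 2) L₁)
  -- The family is sorted by the trace on a fixed member `L₁`; `ref` picks one member for each trace
  -- that occurs, with `⊥` as an irrelevant default.
  let J : Submodule (ZMod 2) (PauliVec n) → Submodule (ZMod 2) L₁ := fun L => L.comap L₁.subtype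
  have hinf : ∀ {L L'}, J L = J L' → L₁ ⊓ L = L₁ ⊓ L' := by
    intro L L' h
    have := congrArg (Submodule.map L₁.subtype) h
    simpa only [J, Submodule.map_comap_subtype] using this
  have href : ∀ j : Submodule (ZMod 2) L₁, ∃ L : Submodule (ZMod 2) (PauliVec n),
      (∃ L' ∈ F, J L' = j) → L ∈ F ∧ J L = j := by
    intro j
    by_cases h : ∃ L' ∈ F, J L' = j
    · obtain ⟨L, hL⟩ := h
      exact ⟨L, fun _ => hL⟩
    · exact ⟨⊥, fun h' => absurd h' h⟩
  choose ref hrefj using href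
  have hnear : ∀ L ∈ F, ∃ uv : PauliVec n × PauliVec n,
      (L : Set (PauliVec n)) = neighbour (ref (J L)) uv.1 uv.2 := by
    intro L hL
    obtain ⟨hr, hrJ⟩ := hrefj (J L) ⟨L, hL, rfl⟩
    obtain ⟨u, hu, v, hv, huv⟩ := hS.exists_near (hF _ hL₁) (hF _ hr) (hF _ hL) (hU _ hL₁)
      (hU _ hr) (hU _ hL) (hinf hrJ)
    exact ⟨(u, v), eq_neighbour (hF _ hr) (hF _ hL) hu hv huv⟩
  choose! uv huv using hnear
  have hcard : F.card ≤ (Finset.univ : Finset (Submodule (ZMod 2) L₁ ×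
      (PauliVec n × PauliVec n))).card := by
    refine Finset.card_le_card_of_injOn (fun L => (J L, uv L)) (fun _ _ => Finset.mem_univ _) ?_
    intro L hL L' hL' h
    have h1 : J L = J L' := congrArg Prod.fst h
    have h2 : uv L = uv L' := congrArg Prod.snd h
    apply SetLike.coe_injective
    rw [huv L hL, huv L' hL', h1, h2]
  rw [Finset.card_univ, Fintype.card_prod, Fintype.card_prod, card_eq,
    ← Nat.card_eq_fintype_card] at hcard
  refine hcard.trans ((Nat.mul_le_mul_right _
    (card_submodule_le L₁ (finrank_eq_of_orthogonal (hF _ hL₁)))).trans_eq ?_)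
  rw [show (4 : ℕ) = 2 ^ 2 from rfl, ← pow_mul, ← pow_add, ← pow_add]
  congr 1
  ring

end PauliVec

/-! ## Circuits with one gate per qubit -/

/-- If every qubit is the target of at most one gate and no control is targeted later, then the
amplitudes are products of one matrix element per gate. -/
theorem UCGate.foldl_apply {Q A : Type} [DecidableEq Q] [Fintype Q] (G : Q → UCGate Q A)
    (hG : ∀ q, (G q).target = q) (x : A) (l : List Q) (hl : l.Nodup)
    (hp : l.Pairwise fun q q' => q' ∉ (G q).controls) :
    (l.map G).foldl (fun ψ g => g.apply x ψ) (fun z => if z = 0 then 1 else 0) =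
      fun z : Q → Fin 2 => ∏ q, if q ∈ l then
        ((G q).unitary x (fun p => z p) : Matrix (Fin 2) (Fin 2) ℂ) (z q) 0
        else if z q = 0 then 1 else 0 := by
  induction l using List.reverseRecOn with
  | nil =>
    funext z
    simp only [List.map_nil, List.foldl_nil, List.not_mem_nil, if_false]
    rw [Finset.prod_ite_zero]
    simp [funext_iff]
  | append_singleton l q ih =>
    rw [List.nodup_append] at hl
    rw [List.pairwise_append] at hp
    have hq : q ∉ l := fun h => hl.2.2 q h q (by simp) rfl
    rw [List.map_append, List.foldl_append, ih hl.1 hp.1]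
    funext z
    simp only [List.map_cons, List.map_nil, List.foldl_cons, List.foldl_nil, UCGate.apply, hG]
    -- Qubit `q` is still `|0⟩` and controls no earlier gate, so changing its value affects only its
    -- own factor.
    have h1 : ∀ b : Fin 2, (∏ p, if p ∈ l then
        ((G p).unitary x (fun p' => Function.update z q b p') : Matrix (Fin 2) (Fin 2) ℂ)
          (Function.update z q b p) 0
        else if Function.update z q b p = 0 then 1 else 0) =
        (if b = 0 then 1 else 0) * ∏ p ∈ Finset.univ.erase q, if p ∈ l then
          ((G p).unitary x (fun p' => z p') : Matrix (Fin 2) (Fin 2) ℂ) (z p) 0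
          else if z p = 0 then 1 else 0 := by
      intro b
      rw [← Finset.mul_prod_erase _ _ (Finset.mem_univ q)]
      congr 1
      · simp [hq]
      · refine Finset.prod_congr rfl fun p hp' => ?_
        have hne : p ≠ q := Finset.ne_of_mem_erase hp'
        rw [Function.update_of_ne hne]
        by_cases hpl : p ∈ l
        · have hctl : q ∉ (G p).controls := hp.2.2 p hpl q (by simp)
          have : (fun p' : {p' // p' ∈ (G p).controls} => Function.update z q b p') =
              fun p' : {p' // p' ∈ (G p).controls} => z p' := by
            funext p'
            exact Function.update_of_ne (fun h => hctl (by rw [← h]; exact p'.2)) _ _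
          rw [this]
        · simp [hpl]
    simp only [h1]
    rw [Fin.sum_univ_two, ← Finset.mul_prod_erase _ _ (Finset.mem_univ q)]
    simp only [List.mem_append, List.mem_singleton, or_true, if_true, one_ne_zero, if_false,
      zero_mul, mul_zero, add_zero, one_mul]
    congr 1
    refine Finset.prod_congr rfl fun p hp' => ?_
    have hne : p ≠ q := Finset.ne_of_mem_erase hp'
    simp [hne]

/-! ## Sums over paths -/

/-- The path `a₀, a 0, a 1, …`. -/
def pathFrom {A : Type} {T : ℕ} (a₀ : A) (a : Fin T → A) (s : ℕ) : A :=
  if h : 0 < s ∧ s - 1 < T then a ⟨s - 1, h.2⟩ else a₀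

theorem pathFrom_succ {A : Type} {T : ℕ} (a₀ : A) (a : Fin T → A) (t : Fin T) :
    pathFrom a₀ a (t + 1) = a t := by
  simp [pathFrom]

/-- A sum over paths of a product of transition amplitudes is a product of matrices. -/
theorem sum_path_prod {A : Type} [Fintype A] (a₀ : A) (G : ℕ → A → A → ℂ)
    (R : ℕ → A → ℂ) (hR₀ : ∀ f : A → ℂ, ∑ w, R 0 w * f w = f a₀)
    (hR : ∀ t w, R (t + 1) w = ∑ w', G t w' w * R t w') (T : ℕ) (f : A → ℂ) :
    ∑ a : Fin T → A, (∏ t : Fin T, G t (pathFrom a₀ a t) (pathFrom a₀ a (t + 1))) *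
      f (pathFrom a₀ a T) = ∑ w, R T w * f w := by
  induction T generalizing f with
  | zero => simp [hR₀, pathFrom]
  | succ T ih =>
    -- The last vertex of the path is split off and its transition is absorbed into `f`.
    rw [← (Fin.snocEquiv fun _ : Fin (T + 1) => A).sum_comp, Fintype.sum_prod_type,
      Finset.sum_comm]
    have hp : ∀ (b : A) (a : Fin T → A) (s : ℕ), s ≤ T →
        pathFrom a₀ ((Fin.snocEquiv fun _ : Fin (T + 1) => A) (b, a)) s = pathFrom a₀ a s := by
      intro b a s hs
      unfold pathFrom
      by_cases h : 0 < s
      · rw [dif_pos ⟨h, by omega⟩, dif_pos ⟨h, by omega⟩]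
        simp only [Fin.snocEquiv, Equiv.coe_fn_mk]
        exact Fin.snoc_castSucc (α := fun _ => A) b a ⟨s - 1, by omega⟩
      · rw [dif_neg (fun h' => h h'.1), dif_neg (fun h' => h h'.1)]
    have hl : ∀ (b : A) (a : Fin T → A),
        pathFrom a₀ ((Fin.snocEquiv fun _ : Fin (T + 1) => A) (b, a)) (T + 1) = b := by
      intro b a
      have := pathFrom_succ a₀ ((Fin.snocEquiv fun _ : Fin (T + 1) => A) (b, a)) (Fin.last T)
      rw [Fin.val_last] at this
      rw [this]
      exact Fin.snoc_last (α := fun _ => A) b a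
    have h1 : ∀ (a : Fin T → A) (b : A),
        (∏ t : Fin (T + 1), G t
          (pathFrom a₀ ((Fin.snocEquiv fun _ : Fin (T + 1) => A) (b, a)) t)
          (pathFrom a₀ ((Fin.snocEquiv fun _ : Fin (T + 1) => A) (b, a)) (t + 1))) *
          f (pathFrom a₀ ((Fin.snocEquiv fun _ : Fin (T + 1) => A) (b, a)) (T + 1)) =
        (∏ t : Fin T, G t (pathFrom a₀ a t) (pathFrom a₀ a (t + 1))) *
          (G T (pathFrom a₀ a T) b * f b) := by
      intro a b
      rw [Fin.prod_univ_castSucc, hl, ← mul_assoc]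
      congr 2
      · refine Finset.prod_congr rfl fun t _ => ?_
        simp only [Fin.val_castSucc]
        rw [hp b a t (by omega), hp b a (t + 1) (by omega)]
      · simp only [Fin.val_last]
        rw [hp b a T le_rfl, hl]
    have h2 : ∀ a : Fin T → A, ∑ b, (∏ t : Fin T, G t (pathFrom a₀ a t) (pathFrom a₀ a (t + 1))) *
        (G T (pathFrom a₀ a T) b * f b) =
        (∏ t : Fin T, G t (pathFrom a₀ a t) (pathFrom a₀ a (t + 1))) *
          (fun w => ∑ b, G T w b * f b) (pathFrom a₀ a T) := fun a => by rw [Finset.mul_sum]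
    rw [Finset.sum_congr rfl fun a _ => (Finset.sum_congr rfl fun b _ => h1 a b).trans (h2 a),
      ih fun w => ∑ b, G T w b * f b]
    simp only [hR, Finset.mul_sum, Finset.sum_mul]
    rw [Finset.sum_comm]
    exact Finset.sum_congr rfl fun b _ => Finset.sum_congr rfl fun w _ => by ring

/-! ## The teleportation circuit -/

/-- The Hadamard gate. -/
noncomputable def hadamardMat : Matrix (Fin 2) (Fin 2) ℂ :=
  ((Real.sqrt 2 : ℝ) : ℂ)⁻¹ • !![1, 1; 1, -1]

theorem sqrt_two_inv_mul : ((Real.sqrt 2 : ℝ) : ℂ)⁻¹ * ((Real.sqrt 2 : ℝ) : ℂ)⁻¹ = 1 / 2 := by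
  rw [← mul_inv, ← Complex.ofReal_mul, Real.mul_self_sqrt (by norm_num)]
  norm_num

theorem hadamardMat_mem : hadamardMat ∈ Matrix.unitaryGroup (Fin 2) ℂ := by
  rw [Matrix.mem_unitaryGroup_iff, hadamardMat, star_smul, smul_mul_smul_comm, Complex.star_def,
    map_inv₀, Complex.conj_ofReal, sqrt_two_inv_mul]
  ext i j
  rw [Matrix.smul_apply, Matrix.mul_apply, Fin.sum_univ_two]
  simp only [Matrix.star_apply]
  fin_cases i <;> fin_cases j <;> simp <;> norm_num

/-- A qubit that is prepared in `|+⟩` and measured in the X basis with result `s` gives its value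
`m` this weight in the path sum. -/
theorem hadamardMat_mul (s m : Fin 2) :
    hadamardMat s m * hadamardMat m 0 = 1 / 2 * (-1 : ℂ) ^ ((s : ℕ) * m) := by
  have h := sqrt_two_inv_mul
  fin_cases s <;> fin_cases m <;> simp [hadamardMat] at h ⊢ <;> exact h

/-- The Hadamard gate as an element of the unitary group. -/
noncomputable def hadamardGate : Matrix.unitaryGroup (Fin 2) ℂ := ⟨hadamardMat, hadamardMat_mem⟩

/-- A Pauli gate as an element of the unitary group. -/
def Pauli.gate (p : Pauli) : Matrix.unitaryGroup (Fin 2) ℂ :=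
  ⟨p.mat, by
    rw [Matrix.mem_unitaryGroup_iff, Matrix.star_eq_conjTranspose, p.mat_conjTranspose,
      p.mat_mul_self]⟩

/-- The roles of the `2 n + 1` qubits of a node: the measurement ancilla, `n` qubits that are the
first halves of entangled pairs shared with the next node, and `n` data qubits. -/
noncomputable def qubitRole (n : ℕ) : Option (Fin n ⊕ Fin n) ≃ Fin (2 * n + 1) :=
  Fintype.equivFinOfCardEq (by simp; ring)

/-- The ancilla of a node. -/
noncomputable def ancillaQubit (n : ℕ) : Fin (2 * n + 1) := qubitRole n none

/-- A qubit that is entangled with the next node. -/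
noncomputable def linkQubit {n : ℕ} (i : Fin n) : Fin (2 * n + 1) := qubitRole n (some (.inl i))

/-- A data qubit. -/
noncomputable def dataQubit {n : ℕ} (i : Fin n) : Fin (2 * n + 1) := qubitRole n (some (.inr i))

theorem ancillaQubit_ne_dataQubit {n : ℕ} (i : Fin n) : ancillaQubit n ≠ dataQubit i := fun h => by
  simpa using (qubitRole n).injective h

theorem linkQubit_ne_dataQubit {n : ℕ} (i j : Fin n) : linkQubit i ≠ dataQubit j := fun h => by
  simpa using (qubitRole n).injective h

/-- The configurations of a node, split by the roles of its qubits. -/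
noncomputable def nodeEquiv (n : ℕ) : (Fin (2 * n + 1) → Fin 2) ≃
    (Fin n → Fin 2) × (Fin 2 × (Fin n → Fin 2)) where
  toFun w := (fun i => w (linkQubit i), w (ancillaQubit n), fun i => w (dataQubit i))
  invFun p j := match (qubitRole n).symm j with
    | none => p.2.1
    | some (.inl i) => p.1 i
    | some (.inr i) => p.2.2 i
  left_inv w := by
    funext j
    obtain ⟨o, rfl⟩ := (qubitRole n).surjective j
    simp only [Equiv.symm_apply_apply]
    rcases o with _ | i | i <;> rfl
  right_inv p := by
    simp [linkQubit, ancillaQubit, dataQubit]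

theorem prod_node {n : ℕ} (f : Fin (2 * n + 1) → ℂ) :
    ∏ j, f j = f (ancillaQubit n) * ((∏ i, f (linkQubit i)) * ∏ i : Fin n, f (dataQubit i)) := by
  rw [← (qubitRole n).prod_comp, Fintype.prod_option, Fintype.prod_sum_type]
  rfl

section Circuit

variable {n T : ℕ}

/-- The link qubits of the previous node. -/
noncomputable def prevLink (z : Fin T × Fin (2 * n + 1) → Fin 2) (t : Fin T) (i : Fin n) : Fin 2 :=
  if h : 0 < (t : ℕ) then z (⟨t - 1, by omega⟩, linkQubit i) else 0

/-- The gate on a qubit, given the values of all qubits: the ancilla and the link qubits are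
brought to the `X` basis; a data qubit receives the value of the link qubit of the previous node,
then the controlled Pauli operator, then the controlled gate of the Bell measurement. -/
noncomputable def teleportUnitary (x : Fin T → PauliString n)
    (z : Fin T × Fin (2 * n + 1) → Fin 2) (q : Fin T × Fin (2 * n + 1)) :
    Matrix.unitaryGroup (Fin 2) ℂ :=
  match (qubitRole n).symm q.2 with
  | none => hadamardGate
  | some (.inl _) => hadamardGate
  | some (.inr i) => Pauli.X.gate ^ (z (q.1, linkQubit i) : ℕ) *
      (x q.1 i).gate ^ (z (q.1, ancillaQubit n) : ℕ) * Pauli.X.gate ^ (prevLink z q.1 i : ℕ)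

open Classical in
/-- The control qubits: data qubits are controlled by the other qubits of the same node and of the
previous one. -/
noncomputable def teleportControls (q : Fin T × Fin (2 * n + 1)) :
    Finset (Fin T × Fin (2 * n + 1)) :=
  {p | (∃ i : Fin n, q.2 = dataQubit i) ∧ (¬ ∃ i : Fin n, p.2 = dataQubit i) ∧
    (p.1 = q.1 ∨ (p.1 : ℕ) + 1 = q.1)}

theorem mem_teleportControls {q p : Fin T × Fin (2 * n + 1)} : p ∈ teleportControls q ↔
    (∃ i : Fin n, q.2 = dataQubit i) ∧ (¬ ∃ i : Fin n, p.2 = dataQubit i) ∧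
    (p.1 = q.1 ∨ (p.1 : ℕ) + 1 = q.1) := by
  simp [teleportControls]

open Classical in
/-- Extension of a partial assignment by zero. -/
noncomputable def extendZero {Q : Type} {s : Finset Q} (v : {q // q ∈ s} → Fin 2) (q : Q) : Fin 2 :=
  if h : q ∈ s then v ⟨q, h⟩ else 0

/-- The gate that targets the qubit `q`. -/
noncomputable def teleportGate (q : Fin T × Fin (2 * n + 1)) :
    UCGate (Fin T × Fin (2 * n + 1)) (Fin T → PauliString n) where
  target := q
  controls := teleportControls q
  target_notMem h := (mem_teleportControls.1 h).2.1 (mem_teleportControls.1 h).1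
  unitary x v := teleportUnitary x (extendZero v) q

theorem extendZero_of_mem {Q : Type} {s : Finset Q} (z : Q → Fin 2) {q : Q} (h : q ∈ s) :
    extendZero (fun p : {p // p ∈ s} => z p) q = z q := by
  simp [extendZero, h]

/-- `teleportUnitary` is written in terms of all qubits; what has to be seen is that it reads only
the control qubits. -/
theorem teleportGate_unitary (x : Fin T → PauliString n) (z : Fin T × Fin (2 * n + 1) → Fin 2)
    (q : Fin T × Fin (2 * n + 1)) :
    (teleportGate q).unitary x (fun p => z p) = teleportUnitary x z q := by
  obtain ⟨t, j⟩ := q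
  obtain ⟨o, rfl⟩ := (qubitRole n).surjective j
  rcases o with _ | i | i
  · simp [teleportGate, teleportUnitary]
  · simp [teleportGate, teleportUnitary]
  · have hlink : ∀ s : Fin T, (s = t ∨ (s : ℕ) + 1 = t) →
        (s, linkQubit i) ∈ teleportControls (t, dataQubit i) := fun s hs =>
      mem_teleportControls.2 ⟨⟨i, rfl⟩, fun ⟨i', h⟩ => linkQubit_ne_dataQubit _ _ h, hs⟩
    have hanc : (t, ancillaQubit n) ∈ teleportControls (t, dataQubit i) :=
      mem_teleportControls.2 ⟨⟨i, rfl⟩, fun ⟨i', h⟩ => ancillaQubit_ne_dataQubit _ h, .inl rfl⟩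
    have hprev : prevLink (extendZero (s := teleportControls (t, dataQubit i)) fun p => z p) t i =
        prevLink z t i := by
      unfold prevLink
      by_cases h : 0 < (t : ℕ)
      · rw [dif_pos h, dif_pos h]
        exact extendZero_of_mem z (hlink _ (.inr (by simp; omega)))
      · rw [dif_neg h, dif_neg h]
    have e1 := extendZero_of_mem z (hlink t (.inl rfl))
    have e2 := extendZero_of_mem z hanc
    change teleportUnitary x (extendZero (s := teleportControls (t, dataQubit i)) fun p => z p)
      (t, dataQubit i) = teleportUnitary x z (t, dataQubit i)
    simp only [teleportUnitary, dataQubit, Equiv.symm_apply_apply]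
    simp only [dataQubit] at e1 e2 hprev
    rw [e1, e2, hprev]

open Classical in
/-- The order in which the qubits are targeted: the data qubits come last. -/
noncomputable def teleportOrder (n T : ℕ) : List (Fin T × Fin (2 * n + 1)) :=
  (Finset.univ.filter fun q : Fin T × Fin (2 * n + 1) => ¬ ∃ i : Fin n, q.2 = dataQubit i).toList ++
  (Finset.univ.filter fun q : Fin T × Fin (2 * n + 1) => ∃ i : Fin n, q.2 = dataQubit i).toList

theorem mem_teleportOrder (q : Fin T × Fin (2 * n + 1)) : q ∈ teleportOrder n T := by
  simp only [teleportOrder, List.mem_append, Finset.mem_toList, Finset.mem_filter,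
    Finset.mem_univ, true_and]
  exact (em _).symm

theorem nodup_teleportOrder : (teleportOrder n T).Nodup := by
  rw [teleportOrder, List.nodup_append]
  refine ⟨Finset.nodup_toList _, Finset.nodup_toList _, ?_⟩
  rintro a ha b hb rfl
  simp only [Finset.mem_toList, Finset.mem_filter] at ha hb
  exact ha.2 hb.2

theorem pairwise_teleportOrder :
    (teleportOrder n T).Pairwise fun q q' => q' ∉ (teleportGate q).controls := by
  rw [teleportOrder, List.pairwise_append]
  refine ⟨?_, ?_, ?_⟩
  · refine List.Pairwise.imp_of_mem (R := fun _ _ => True) (fun {a b} ha _ _ h => ?_)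
      (List.pairwise_of_forall fun _ _ => trivial)
    simp only [Finset.mem_toList, Finset.mem_filter] at ha
    exact ha.2 (mem_teleportControls.1 h).1
  · refine List.Pairwise.imp_of_mem (R := fun _ _ => True) (fun {a b} _ hb _ h => ?_)
      (List.pairwise_of_forall fun _ _ => trivial)
    simp only [Finset.mem_toList, Finset.mem_filter] at hb
    exact (mem_teleportControls.1 h).2.1 hb.2
  · intro a ha b _ h
    simp only [Finset.mem_toList, Finset.mem_filter] at ha
    exact ha.2 (mem_teleportControls.1 h).1

/-- The circuit of a chain of `T` teleportation gadgets for Pauli measurements. -/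
noncomputable def teleportCircuit (n T : ℕ) :
    BBQC (Fin T × Fin (2 * n + 1)) (Fin T → PauliString n) where
  gates := (teleportOrder n T).map teleportGate
  ordered := by
    rw [List.pairwise_map]
    exact pairwise_teleportOrder
  basis q := match (qubitRole n).symm q.2 with
    | some (.inr _) => 1
    | _ => hadamardGate

theorem teleportCircuit_isTwoGram (n T : ℕ) : (teleportCircuit n T).IsTwoGram := by
  intro g hg
  obtain ⟨q, -, rfl⟩ := List.mem_map.1 hg
  refine ⟨fun p hp => (mem_teleportControls.1 hp).2.2, fun x x' hx => ?_⟩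
  change x q.1 = x' q.1 at hx
  funext v
  simp only [teleportGate, teleportUnitary, hx]

theorem teleportCircuit_state (x : Fin T → PauliString n) (z : Fin T × Fin (2 * n + 1) → Fin 2) :
    (teleportCircuit n T).state x z =
      ∏ q, (teleportUnitary x z q : Matrix (Fin 2) (Fin 2) ℂ) (z q) 0 := by
  have h := congrFun (UCGate.foldl_apply teleportGate (fun _ => rfl) x (teleportOrder n T)
    nodup_teleportOrder pairwise_teleportOrder) z
  refine h.trans (Finset.prod_congr rfl fun q _ => ?_)
  rw [if_pos (mem_teleportOrder q), teleportGate_unitary]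

end Circuit

/-! ### Amplitudes of the teleportation circuit -/

section Amplitudes

variable {n T : ℕ}

/-- How the output bits of a teleportation gadget are read. -/
noncomputable def teleportReadout (n : ℕ) : Readout n (2 * n + 1) where
  outcome w := w (ancillaQubit n)
  byproduct w := PauliVec.toString fun i => (w (dataQubit i), w (linkQubit i))

/-- The contribution of a node to the amplitude. -/
noncomputable def nodeAmp (P : PauliString n) (y : Fin (2 * n + 1) → Fin 2)
    (a' a : Fin n → Fin 2) (m : Fin 2) (c : Fin n → Fin 2) : ℂ :=
  (hadamardMat (y (ancillaQubit n)) m * hadamardMat m 0) *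
    ((∏ i, hadamardMat (y (linkQubit i)) (a i) * hadamardMat (a i) 0) *
      ∏ i, (1 : Matrix (Fin 2) (Fin 2) ℂ) (y (dataQubit i)) (c i) *
        (Pauli.X.mat ^ (a i : ℕ) * (P i).mat ^ (m : ℕ) * Pauli.X.mat ^ (a' i : ℕ)) (c i) 0)

/-- One-qubit teleportation: the sign `(-1) ^ (s * a)` of the link acts as `Z ^ s` and the shift by
the data result `c` as `X ^ c`. The phase appears because `Y` differs from `Z * X` by a factor. -/
theorem Pauli.exists_teleport_phase (s c : Fin 2) : ∃ ph : ℂ, ‖ph‖ = 1 ∧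
    ∀ (M : Matrix (Fin 2) (Fin 2) ℂ) (a a' : Fin 2),
      (hadamardMat s a * hadamardMat a 0) *
        (Pauli.X.mat ^ (a : ℕ) * M * Pauli.X.mat ^ (a' : ℕ)) c 0 =
      1 / 2 * ph * ((Pauli.ofBits (c, s)).mat * M) a a' := by
  simp only [hadamardMat_mul]
  fin_cases s <;> fin_cases c
  · refine ⟨1, by simp, fun M a a' => ?_⟩
    change _ = 1 / 2 * 1 * (Pauli.I.mat * M) a a'
    rw [Matrix.eta_fin_two M]
    fin_cases a <;> fin_cases a' <;> simp [Pauli.mat]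
  · refine ⟨1, by simp, fun M a a' => ?_⟩
    change _ = 1 / 2 * 1 * (Pauli.X.mat * M) a a'
    rw [Matrix.eta_fin_two M]
    fin_cases a <;> fin_cases a' <;> simp [Pauli.mat]
  · refine ⟨1, by simp, fun M a a' => ?_⟩
    change _ = 1 / 2 * 1 * (Pauli.Z.mat * M) a a'
    rw [Matrix.eta_fin_two M]
    fin_cases a <;> fin_cases a' <;> simp [Pauli.mat]
  · refine ⟨Complex.I, by simp, fun M a a' => ?_⟩
    change _ = 1 / 2 * Complex.I * (Pauli.Y.mat * M) a a'
    rw [Matrix.eta_fin_two M]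
    fin_cases a <;> fin_cases a' <;> simp [Pauli.mat] <;> ring_nf <;> simp <;> ring

/-- The two ancilla values contribute `1` and `± P` with weight `1 / 2`, which is the projector; the
links give the factor `(1 / 2) ^ n` and, with the data results, the byproduct. -/
theorem exists_sum_nodeAmp (y : Fin (2 * n + 1) → Fin 2) : ∃ ph : ℂ, ‖ph‖ = 1 ∧
    ∀ (P : PauliString n) (a' a : Fin n → Fin 2), ∑ mc : Fin 2 × (Fin n → Fin 2),
      nodeAmp P y a' a mc.1 mc.2 = (1 / 2) ^ n * ph *
        (((teleportReadout n).byproduct y).op * P.proj ((teleportReadout n).outcome y)) a a' := by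
  choose ph hph hph' using Pauli.exists_teleport_phase
  refine ⟨∏ i, ph (y (linkQubit i)) (y (dataQubit i)), by rw [norm_prod]; simp [hph],
    fun P a' a => ?_⟩
  have h1 : ∀ m : Fin 2, ∑ c, nodeAmp P y a' a m c =
      (1 / 2 * (-1 : ℂ) ^ ((y (ancillaQubit n) : ℕ) * m)) * ∏ i,
        (1 / 2 * ph (y (linkQubit i)) (y (dataQubit i)) *
          ((Pauli.ofBits (y (dataQubit i), y (linkQubit i))).mat * (P i).mat ^ (m : ℕ))
            (a i) (a' i)) := by
    intro m
    rw [Finset.sum_eq_single fun i => y (dataQubit i)]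
    · rw [nodeAmp, hadamardMat_mul, ← Finset.prod_mul_distrib]
      congr 1
      refine Finset.prod_congr rfl fun i _ => ?_
      rw [Matrix.one_apply_eq, one_mul, hph']
    · intro c _ hc
      obtain ⟨i, hi⟩ := Function.ne_iff.1 hc
      have hz : ∏ i, (1 : Matrix (Fin 2) (Fin 2) ℂ) (y (dataQubit i)) (c i) *
          (Pauli.X.mat ^ (a i : ℕ) * (P i).mat ^ (m : ℕ) * Pauli.X.mat ^ (a' i : ℕ)) (c i) 0 = 0 :=
        Finset.prod_eq_zero (Finset.mem_univ i) (by
          rw [Matrix.one_apply_ne (Ne.symm hi), zero_mul])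
      rw [nodeAmp, hz, mul_zero, mul_zero]
    · simp
  rw [Fintype.sum_prod_type]
  simp only [h1]
  rw [Fin.sum_univ_two]
  simp only [Finset.prod_mul_distrib, Finset.prod_const, Finset.card_univ, Fintype.card_fin]
  have h2 : (((teleportReadout n).byproduct y).op * P.proj ((teleportReadout n).outcome y)) a a' =
      1 / 2 * (∏ i, ((Pauli.ofBits (y (dataQubit i), y (linkQubit i))).mat) (a i) (a' i) +
        (-1 : ℂ) ^ (y (ancillaQubit n) : ℕ) *
          ∏ i, ((Pauli.ofBits (y (dataQubit i), y (linkQubit i))).mat * (P i).mat)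
            (a i) (a' i)) := by
    rw [PauliString.proj, Matrix.mul_smul, Matrix.mul_add, Matrix.mul_one, Matrix.mul_smul,
      Matrix.smul_apply, Matrix.add_apply, Matrix.smul_apply, PauliString.op_mul_apply]
    rfl
  rw [h2]
  simp only [Fin.val_zero, Fin.val_one, pow_zero, pow_one, mul_one, mul_zero]
  ring

theorem prod_eq_prod_nodeAmp (x : Fin T → PauliString n) (y : Fin T × Fin (2 * n + 1) → Fin 2)
    (w : Fin T → (Fin n → Fin 2) × (Fin 2 × (Fin n → Fin 2)))
    (z : Fin T × Fin (2 * n + 1) → Fin 2)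
    (hz : z = fun q => (nodeEquiv n).symm (w q.1) q.2) :
    (∏ q, ((teleportCircuit n T).basis q : Matrix (Fin 2) (Fin 2) ℂ) (y q) (z q)) *
      (teleportCircuit n T).state x z =
    ∏ t, nodeAmp (x t) (fun j => y (t, j)) (pathFrom 0 (fun t => (w t).1) t) (w t).1 (w t).2.1
      (w t).2.2 := by
  have hl : ∀ t i, z (t, linkQubit i) = (w t).1 i := by
    intro t i; rw [hz]; simp [nodeEquiv, linkQubit]
  have ha : ∀ t, z (t, ancillaQubit n) = (w t).2.1 := by
    intro t; rw [hz]; simp [nodeEquiv, ancillaQubit]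
  have hd : ∀ t i, z (t, dataQubit i) = (w t).2.2 i := by
    intro t i; rw [hz]; simp [nodeEquiv, dataQubit]
  have hp : ∀ t i, prevLink z t i = pathFrom 0 (fun t => (w t).1) t i := by
    intro t i
    unfold prevLink pathFrom
    by_cases h : 0 < (t : ℕ)
    · rw [dif_pos h, dif_pos ⟨h, by omega⟩, hl]
    · rw [dif_neg h, dif_neg fun h' => h h'.1]; rfl
  rw [teleportCircuit_state, ← Finset.prod_mul_distrib, Fintype.prod_prod_type]
  refine Finset.prod_congr rfl fun t _ => ?_
  rw [prod_node, nodeAmp]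
  have e1 : ∀ q : Fin T × Fin (2 * n + 1), ((teleportCircuit n T).basis q) =
    match (qubitRole n).symm q.2 with
    | some (.inr _) => 1
    | _ => hadamardGate := fun q => rfl
  congr 1
  · rw [ha, e1]
    simp only [teleportUnitary, ancillaQubit, Equiv.symm_apply_apply]
    rfl
  congr 1
  · refine Finset.prod_congr rfl fun i _ => ?_
    rw [hl, e1]
    simp only [teleportUnitary, linkQubit, Equiv.symm_apply_apply]
    rfl
  · refine Finset.prod_congr rfl fun i _ => ?_
    have e2 : teleportUnitary x z (t, dataQubit i) = Pauli.X.gate ^ (z (t, linkQubit i) : ℕ) *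
      (x t i).gate ^ (z (t, ancillaQubit n) : ℕ) * Pauli.X.gate ^ (prevLink z t i : ℕ) := by
      simp only [teleportUnitary, dataQubit, Equiv.symm_apply_apply]
    rw [hd, e2, hp, hl, ha, e1]
    simp only [dataQubit, Equiv.symm_apply_apply]
    rfl

/-- The output probabilities of the teleportation circuit in terms of the register. -/
theorem teleportCircuit_prob (x : ℕ → PauliString n) (y : ℕ → Fin (2 * n + 1) → Fin 2) (T : ℕ) :
    (teleportCircuit n T).prob (fun t => x t) (fun q => y q.1 q.2) =
      (2 / 2 ^ (2 * n + 1)) ^ T * ‖∑ a, (teleportReadout n).register x y T a‖ ^ 2 := by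
  choose ph hph hph' using exists_sum_nodeAmp (n := n)
  let E : (Fin T → (Fin n → Fin 2) × (Fin 2 × (Fin n → Fin 2))) ≃
      (Fin T × Fin (2 * n + 1) → Fin 2) :=
    (Equiv.piCongrRight fun _ => (nodeEquiv n).symm).trans (Equiv.curry _ _ _).symm
  have h1 : (∑ z : Fin T × Fin (2 * n + 1) → Fin 2,
      (∏ q, ((teleportCircuit n T).basis q : Matrix (Fin 2) (Fin 2) ℂ) (y q.1 q.2) (z q)) *
        (teleportCircuit n T).state (fun t => x t) z) =
      ∑ a : Fin T → Fin n → Fin 2, ∏ t : Fin T, ∑ mc : Fin 2 × (Fin n → Fin 2),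
        nodeAmp (x t) (y t) (pathFrom 0 a t) (a t) mc.1 mc.2 := by
    rw [← E.sum_comp, ← (Equiv.arrowProdEquivProdArrow (Fin T) (fun _ => Fin n → Fin 2)
      (fun _ => Fin 2 × (Fin n → Fin 2))).symm.sum_comp, Fintype.sum_prod_type]
    refine Finset.sum_congr rfl fun a _ => ?_
    rw [Finset.prod_univ_sum, Fintype.piFinset_univ]
    refine Finset.sum_congr rfl fun mc _ => ?_
    exact prod_eq_prod_nodeAmp (fun t => x t) (fun q => y q.1 q.2)
      (fun t => (a t, mc t)) _ rfl
  let G : ℕ → (Fin n → Fin 2) → (Fin n → Fin 2) → ℂ := fun t a' a => (1 / 2) ^ n * ph (y t) *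
    (((teleportReadout n).byproduct (y t)).op *
      (x t).proj ((teleportReadout n).outcome (y t))) a a'
  let R : ℕ → (Fin n → Fin 2) → ℂ := fun t a =>
    (∏ s ∈ Finset.range t, ((1 / 2) ^ n * ph (y s))) * (teleportReadout n).register x y t a
  -- The links of the last node control no further node, so their values are summed with the
  -- constant function 1. Their measurement signs are already part of the byproduct.
  have h2 := sum_path_prod (0 : Fin n → Fin 2) G R
    (by intro f; simp [R, Readout.register, zeroState])
    (by
      intro t w
      simp only [R, G, Readout.register, Finset.prod_range_succ]
      rw [mulVec_mulVec]
      simp only [mulVec, dotProduct, Finset.mul_sum]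
      exact Finset.sum_congr rfl fun w' _ => by ring) T (fun _ => 1)
  simp only [mul_one] at h2
  rw [BBQC.prob, h1]
  simp only [hph', pathFrom_succ, G] at h2 ⊢
  rw [h2]
  simp only [R, ← Finset.mul_sum]
  rw [norm_mul, mul_pow, norm_prod]
  congr 1
  simp only [norm_mul, hph, mul_one, norm_pow, Finset.prod_const, Finset.card_range]
  rw [← pow_mul, ← pow_mul]
  have : (2 / 2 ^ (2 * n + 1) : ℝ) = (1 / 2) ^ (n * 2) := by
    rw [pow_succ, mul_comm n 2, div_pow, one_pow]
    field_simp
  rw [this, ← pow_mul, show ‖(1 / 2 : ℂ)‖ = 1 / 2 by norm_num]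
  congr 1
  ring

end Amplitudes

/-! ## Marginals -/

theorem BBQC.prefixProb_eq_sum {T k : ℕ} {X : Type} (c : BBQC (Fin T × Fin k) (Fin T → X)) {t : ℕ}
    (ht : t < T) (x : ℕ → X) (y : ℕ → Fin k → Fin 2) :
    c.prefixProb t x y = ∑ w, c.prefixProb (t + 1) x (Function.update y t w) := by
  classical
  simp only [BBQC.prefixProb]
  rw [← Finset.sum_fiberwise _ (fun y' : Fin T × Fin k → Fin 2 => fun j => y' (⟨t, ht⟩, j))]
  refine Finset.sum_congr rfl fun w _ => ?_
  refine Finset.sum_congr ?_ fun _ _ => rfl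
  ext y'
  simp only [Finset.mem_filter, Finset.mem_univ, true_and]
  constructor
  · rintro ⟨h1, h2⟩ ⟨s, j⟩ hs
    by_cases hst : (s : ℕ) = t
    · obtain rfl : s = ⟨t, ht⟩ := Fin.ext hst
      simp only [Function.update_self]
      exact congrFun h2 j
    · simp only [Function.update_of_ne hst]
      exact h1 (s, j) (by simp only at hs ⊢; omega)
  · intro h
    refine ⟨fun q hq => ?_, ?_⟩
    · have := h q (by omega)
      rwa [Function.update_of_ne (by omega)] at this
    · funext j
      have := h (⟨t, ht⟩, j) (by simp)
      simpa using this

theorem BBQC.prefixProb_self {T k : ℕ} {X : Type} (c : BBQC (Fin T × Fin k) (Fin T → X))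
    (x : ℕ → X) (y : ℕ → Fin k → Fin 2) : c.prefixProb T x y = c.seqProb x y := by
  classical
  rw [BBQC.prefixProb, BBQC.seqProb, Finset.sum_eq_single_of_mem (fun q => y q.1 q.2) (by simp)]
  intro y' hy' hne
  exact absurd (funext fun q => (Finset.mem_filter.1 hy').2 q q.1.2) hne

theorem BBQC.prefixProb_nonneg {T k : ℕ} {X : Type} (c : BBQC (Fin T × Fin k) (Fin T → X))
    (t : ℕ) (x : ℕ → X) (y : ℕ → Fin k → Fin 2) : 0 ≤ c.prefixProb t x y :=
  Finset.sum_nonneg fun _ _ => by rw [BBQC.prob]; positivity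

theorem Readout.register_congr {n k : ℕ} (r : Readout n k) {x x' : ℕ → PauliString n}
    {y y' : ℕ → Fin k → Fin 2} {t : ℕ} (hx : ∀ s < t, x s = x' s) (hy : ∀ s < t, y s = y' s) :
    r.register x y t = r.register x' y' t := by
  induction t with
  | zero => rfl
  | succ t ih =>
    simp only [Readout.register]
    rw [ih (fun s hs => hx s (by omega)) (fun s hs => hy s (by omega)), hx t (by omega),
      hy t (by omega)]

theorem Readout.register_update {n k : ℕ} (r : Readout n k) (x : ℕ → PauliString n)
    (y : ℕ → Fin k → Fin 2) (t : ℕ) (w : Fin k → Fin 2) :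
    r.register x (Function.update y t w) (t + 1) = (r.byproduct w).op *ᵥ
      ((x t).proj (r.outcome w) *ᵥ r.register x y t) := by
  rw [Readout.register, Function.update_self]
  rw [r.register_congr (fun _ _ => rfl) (fun s hs => Function.update_of_ne (by omega) _ _)]

/-- The readouts of a node are pairs of a measurement outcome and a byproduct. -/
noncomputable def readoutEquiv (n : ℕ) : (Fin (2 * n + 1) → Fin 2) ≃ Fin 2 × PauliVec n :=
  (nodeEquiv n).trans
    { toFun := fun p => (p.2.1, fun i => (p.2.2 i, p.1 i))
      invFun := fun p => (fun i => (p.2 i).2, (p.1, fun i => (p.2 i).1))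
      left_inv := fun _ => rfl
      right_inv := fun _ => rfl }

theorem sum_readout {M : Type*} [AddCommMonoid M] (n : ℕ) (f : Fin 2 → PauliString n → M) :
    ∑ w, f ((teleportReadout n).outcome w) ((teleportReadout n).byproduct w) =
      ∑ s, ∑ b : PauliVec n, f s b.toString := by
  rw [← Fintype.sum_prod_type' (fun s (b : PauliVec n) => f s b.toString),
    ← (readoutEquiv n).sum_comp]
  rfl

theorem exists_readout {n : ℕ} (s : Fin 2) (B : PauliString n) :
    ∃ w, (teleportReadout n).outcome w = s ∧ (teleportReadout n).byproduct w = B := by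
  obtain ⟨b, rfl⟩ := (PauliVec.equivString n).surjective B
  obtain ⟨w, hw⟩ := (readoutEquiv n).surjective (s, b)
  exact ⟨w, congrArg Prod.fst hw, congrArg (fun p => (Prod.snd p).toString) hw⟩

theorem card_pauliVec (n : ℕ) : Fintype.card (PauliVec n) = 2 ^ (2 * n) := by
  rw [PauliVec.card_eq, pow_mul]; norm_num

theorem sum_sqNorm_register_succ {n : ℕ} (x : ℕ → PauliString n)
    (y : ℕ → Fin (2 * n + 1) → Fin 2) (t : ℕ) :
    ∑ w, ((teleportReadout n).register x (Function.update y t w) (t + 1)).sqNorm =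
      2 ^ (2 * n) * ((teleportReadout n).register x y t).sqNorm := by
  simp only [Readout.register_update, QState.sqNorm_op]
  rw [sum_readout n fun s _ => QState.sqNorm ((x t).proj s *ᵥ (teleportReadout n).register x y t)]
  simp only [Finset.sum_const, Finset.card_univ, card_pauliVec, nsmul_eq_mul]
  rw [← Finset.mul_sum, QState.sum_sqNorm_proj]
  norm_num

/-- The sum over byproducts replaces the overlap with the all-ones vector, of squared norm `2 ^ n`,
by the norm of the register. This is why the Born probabilities hold for prefixes shorter than `T`.
-/
theorem sum_norm_sum_register_succ {n : ℕ} (x : ℕ → PauliString n)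
    (y : ℕ → Fin (2 * n + 1) → Fin 2) (t : ℕ) :
    ∑ w, ‖∑ a, (teleportReadout n).register x (Function.update y t w) (t + 1) a‖ ^ 2 =
      2 ^ (2 * n) * ((teleportReadout n).register x y t).sqNorm := by
  simp only [Readout.register_update]
  rw [sum_readout n fun s B => ‖∑ a, (B.op *ᵥ
    ((x t).proj s *ᵥ (teleportReadout n).register x y t)) a‖ ^ 2]
  have h := fun s : Fin 2 => QState.sum_norm_ip_sq (fun _ => 1)
    ((x t).proj s *ᵥ (teleportReadout n).register x y t)
  simp only [QState.ip, star_one, one_mul] at h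
  simp only [h]
  have h1 : QState.sqNorm (fun _ : Fin n → Fin 2 => (1 : ℂ)) = 2 ^ n := by
    simp [QState.sqNorm]
  rw [h1, ← Finset.mul_sum, ← Finset.mul_sum, QState.sum_sqNorm_proj, ← mul_assoc]
  congr 1
  rw [← pow_add, two_mul]

theorem teleportCircuit_simulates (n T : ℕ) :
    Simulates (teleportReadout n) (teleportCircuit n T) := by
  -- Induction from the end of the chain: `d` is the number of nodes after node `t`, and each
  -- marginalization multiplies by `2 / D * 4 ^ n = 1`.
  have h : ∀ d t : ℕ, t + d + 1 = T → ∀ (x : ℕ → PauliString n) (y : ℕ → Fin (2 * n + 1) → Fin 2),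
      (teleportCircuit n T).prefixProb t x y =
        (2 / 2 ^ (2 * n + 1) : ℝ) ^ t * ((teleportReadout n).register x y t).sqNorm := by
    have hD : (2 / 2 ^ (2 * n + 1) : ℝ) * 2 ^ (2 * n) = 1 := by rw [pow_succ]; field_simp
    intro d
    induction d with
    | zero =>
      rintro t rfl x y
      rw [BBQC.prefixProb_eq_sum _ (by omega)]
      simp only [add_zero, BBQC.prefixProb_self, BBQC.seqProb, teleportCircuit_prob]
      rw [← Finset.mul_sum, sum_norm_sum_register_succ, pow_succ]
      linear_combination (2 / 2 ^ (2 * n + 1) : ℝ) ^ t *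
        ((teleportReadout n).register x y t).sqNorm * hD
    | succ d ih =>
      intro t ht x y
      rw [BBQC.prefixProb_eq_sum _ (by omega)]
      rw [Finset.sum_congr rfl fun w _ => ih (t + 1) (by omega) x (Function.update y t w)]
      rw [← Finset.mul_sum, sum_sqNorm_register_succ, pow_succ]
      linear_combination (2 / 2 ^ (2 * n + 1) : ℝ) ^ t *
        ((teleportReadout n).register x y t).sqNorm * hD
  intro t ht x y
  obtain ⟨d, rfl⟩ := Nat.exists_eq_add_of_lt ht
  exact h d t rfl x y

/-! ## Classical models -/

/-- The joint probabilities `p` of outputs and hidden state are generated by the transition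
kernels `K`. -/
structure IsStochastic {V : ℕ} {X Y : Type} [Fintype Y] (p : (ℕ → X) → (ℕ → Y) → ℕ → Fin V → ℝ)
    (K : ℕ → Fin V → X → Y → Fin V → ℝ) : Prop where
  kernel_nonneg : ∀ t h x y h', 0 ≤ K t h x y h'
  kernel_sum : ∀ t h x, ∑ y, ∑ h', K t h x y h' = 1
  init : ∃ f : Fin V → ℝ, (∀ h, 0 ≤ f h) ∧ ∀ x y, p x y 0 = f
  succ : ∀ x y t h', p x y (t + 1) h' = ∑ h, p x y t h * K t h (x t) (y t) h'

theorem TranslationHMM.isStochastic {V : ℕ} {X Y : Type} [Fintype Y] (H : TranslationHMM V X Y) :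
    IsStochastic H.forward fun t h x y h' => H.trans t h x h' * H.emit t h' y where
  kernel_nonneg t h x y h' := mul_nonneg ((H.trans_mem t h x).1 h') ((H.emit_mem t h').1 y)
  kernel_sum t h x := by
    rw [Finset.sum_comm]
    simp only [← Finset.mul_sum]
    rw [Finset.sum_congr rfl fun h' _ => by rw [(H.emit_mem t h').2, mul_one]]
    exact (H.trans_mem t h x).2
  init := ⟨H.init, H.init_mem.1, fun _ _ => rfl⟩
  succ _ _ _ _ := rfl

theorem OntologicalModel.isStochastic {V : ℕ} {X Y : Type} [Fintype Y]
    (O : OntologicalModel V X Y) :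
    IsStochastic O.forward fun t h x y h' => O.resp t h x y * O.update t h x y h' where
  kernel_nonneg t h x y h' := mul_nonneg ((O.resp_mem t h x).1 y) ((O.update_mem t h x y).1 h')
  kernel_sum t h x := by
    simp only [← Finset.mul_sum]
    rw [Finset.sum_congr rfl fun y _ => by rw [(O.update_mem t h x y).2, mul_one]]
    exact (O.resp_mem t h x).2
  init := ⟨O.init, O.init_mem.1, fun _ _ => rfl⟩
  succ _ _ _ _ := rfl

namespace IsStochastic

section Basic

variable {V : ℕ} {X Y : Type} [Fintype Y] {p : (ℕ → X) → (ℕ → Y) → ℕ → Fin V → ℝ}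
  {K : ℕ → Fin V → X → Y → Fin V → ℝ}

theorem nonneg (hp : IsStochastic p K) (x : ℕ → X) (y : ℕ → Y) (t : ℕ) (h : Fin V) :
    0 ≤ p x y t h := by
  induction t generalizing h with
  | zero =>
    obtain ⟨f, hf, h0⟩ := hp.init
    rw [h0]; exact hf h
  | succ t ih =>
    rw [hp.succ]
    exact Finset.sum_nonneg fun h' _ => mul_nonneg (ih h') (hp.kernel_nonneg _ _ _ _ _)

theorem congr (hp : IsStochastic p K) {x x' : ℕ → X} {y y' : ℕ → Y} {t : ℕ}
    (hx : ∀ s < t, x s = x' s) (hy : ∀ s < t, y s = y' s) : p x y t = p x' y' t := by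
  induction t with
  | zero =>
    obtain ⟨f, -, h0⟩ := hp.init
    rw [h0, h0]
  | succ t ih =>
    funext h
    rw [hp.succ, hp.succ, ih (fun s hs => hx s (by omega)) (fun s hs => hy s (by omega)),
      hx t (by omega), hy t (by omega)]

theorem sum_eq_sum_update (hp : IsStochastic p K) (x : ℕ → X) (y : ℕ → Y) (t : ℕ) :
    ∑ h, p x y t h = ∑ w, ∑ h', p x (Function.update y t w) (t + 1) h' := by
  have h1 : ∀ w h', p x (Function.update y t w) (t + 1) h' =
      ∑ h, p x y t h * K t h (x t) w h' := by
    intro w h'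
    rw [hp.succ, Function.update_self, hp.congr (fun _ _ => rfl)
      (fun s hs => Function.update_of_ne (by omega) w y)]
  simp only [h1]
  rw [Finset.sum_congr rfl fun w _ => Finset.sum_comm, Finset.sum_comm]
  refine Finset.sum_congr rfl fun h _ => ?_
  simp only [← Finset.mul_sum]
  rw [hp.kernel_sum, mul_one]

theorem exists_kernel_ne_zero (hp : IsStochastic p K) (t : ℕ) (h : Fin V) (x : X) :
    ∃ w h', K t h x w h' ≠ 0 := by
  by_contra hcon
  push Not at hcon
  have := hp.kernel_sum t h x
  simp [hcon] at this

theorem step_ne_zero (hp : IsStochastic p K) {x : ℕ → X} {y : ℕ → Y} {t : ℕ} {h h' : Fin V}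
    (hh : p x y t h ≠ 0) {P : X} {w : Y} (hK : K t h P w h' ≠ 0) :
    p (Function.update x t P) (Function.update y t w) (t + 1) h' ≠ 0 := by
  rw [hp.succ, Function.update_self, Function.update_self,
    hp.congr (fun s hs => Function.update_of_ne (by omega) P x)
      (fun s hs => Function.update_of_ne (by omega) w y)]
  refine ne_of_gt (Finset.sum_pos' (fun h'' _ =>
    mul_nonneg (hp.nonneg _ _ _ _) (hp.kernel_nonneg _ _ _ _ _)) ⟨h, Finset.mem_univ _, ?_⟩)
  exact mul_pos (lt_of_le_of_ne (hp.nonneg _ _ _ _) hh.symm)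
    (lt_of_le_of_ne (hp.kernel_nonneg _ _ _ _ _) hK.symm)

end Basic

variable {V T k n : ℕ}

/-- A marginal of nonnegative terms vanishes exactly when every term does, so equality of the zero
patterns at length `T` descends to all prefixes. -/
theorem sum_eq_zero_iff {X : Type} {p : (ℕ → X) → (ℕ → Fin k → Fin 2) → ℕ → Fin V → ℝ}
    {K : ℕ → Fin V → X → (Fin k → Fin 2) → Fin V → ℝ}
    (hp : IsStochastic p K) {c : BBQC (Fin T × Fin k) (Fin T → X)} (hpat : SamePattern p c)
    {t : ℕ} (ht : t ≤ T) (x : ℕ → X) (y : ℕ → Fin k → Fin 2) :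
    ∑ h, p x y t h = 0 ↔ c.prefixProb t x y = 0 := by
  induction ht using Nat.decreasingInduction generalizing y with
  | self => rw [BBQC.prefixProb_self]; exact hpat x y
  | of_succ t ht ih =>
    rw [hp.sum_eq_sum_update, c.prefixProb_eq_sum ht,
      Finset.sum_eq_zero_iff_of_nonneg fun w _ => Finset.sum_nonneg fun h _ => hp.nonneg _ _ _ _,
      Finset.sum_eq_zero_iff_of_nonneg fun w _ => c.prefixProb_nonneg _ _ _]
    exact forall_congr' fun w => imp_congr_right fun _ => ih _

variable {p : (ℕ → PauliString n) → (ℕ → Fin k → Fin 2) → ℕ → Fin V → ℝ}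
  {K : ℕ → Fin V → PauliString n → (Fin k → Fin 2) → Fin V → ℝ} {r : Readout n k}
  {c : BBQC (Fin T × Fin k) (Fin T → PauliString n)}

theorem prefixProb_eq_zero_iff (hsim : Simulates r c) {t : ℕ} (ht : t < T)
    (x : ℕ → PauliString n) (y : ℕ → Fin k → Fin 2) :
    c.prefixProb t x y = 0 ↔ r.register x y t = 0 := by
  rw [hsim t ht, mul_eq_zero, QState.sqNorm_eq_zero_iff]
  have : ((2 / 2 ^ k : ℝ) ^ t) ≠ 0 := by positivity
  simp [this]

theorem register_ne_zero (hp : IsStochastic p K) (hpat : SamePattern p c) (hsim : Simulates r c)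
    {t : ℕ} (ht : t < T) {x : ℕ → PauliString n} {y : ℕ → Fin k → Fin 2} {h : Fin V}
    (hh : p x y t h ≠ 0) : r.register x y t ≠ 0 := by
  rw [Ne, ← prefixProb_eq_zero_iff hsim ht, ← hp.sum_eq_zero_iff hpat ht.le,
    Finset.sum_eq_zero_iff_of_nonneg fun h _ => hp.nonneg _ _ _ _]
  exact fun h0 => hh (h0 h (Finset.mem_univ _))

theorem exists_ne_zero (hp : IsStochastic p K) (hpat : SamePattern p c) (hsim : Simulates r c)
    {t : ℕ} (ht : t < T) {x : ℕ → PauliString n} {y : ℕ → Fin k → Fin 2}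
    (hreg : r.register x y t ≠ 0) : ∃ h, p x y t h ≠ 0 := by
  by_contra hcon
  push Not at hcon
  rw [Ne, ← prefixProb_eq_zero_iff hsim ht, ← hp.sum_eq_zero_iff hpat ht.le] at hreg
  exact hreg (by simp [hcon])

end IsStochastic

/-! ### From a shared hidden state to consistent signs -/

theorem Readout.register_update_update {n k : ℕ} (r : Readout n k) (x : ℕ → PauliString n)
    (y : ℕ → Fin k → Fin 2) (t : ℕ) (P : PauliString n) (w : Fin k → Fin 2) :
    r.register (Function.update x t P) (Function.update y t w) (t + 1) = (r.byproduct w).op *ᵥ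
      (P.proj (r.outcome w) *ᵥ r.register x y t) := by
  rw [Readout.register, Function.update_self, Function.update_self]
  rw [r.register_congr (x := Function.update x t P) (x' := x)
    (fun s hs => Function.update_of_ne (by omega) _ _)
    (fun s hs => Function.update_of_ne (by omega) w y)]

/-- A byproduct commutes or anticommutes with `Q`, so moving it past the projector at most flips the
outcome. -/
theorem PauliVec.exists_proj_mul_op {n : ℕ} (Q B : PauliString n) (s : Fin 2) :
    ∃ s', Q.proj s * B.op = B.op * Q.proj s' := by
  obtain ⟨q, rfl⟩ := (equivString n).surjective Q
  obtain ⟨b, rfl⟩ := (equivString n).surjective B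
  have hsq : signChar (symp n q b) * signChar (symp n q b) = 1 := by
    rcases zmod_two_cases (symp n q b) with h | h <;> simp [h]
  obtain ⟨s', hs'⟩ := exists_sign (a := signChar (symp n q b) * (-1) ^ (s : ℕ)) (by
    rw [mul_mul_mul_comm, hsq, sign_mul_self, one_mul])
  refine ⟨s', ?_⟩
  simp only [PauliString.proj, hs', Matrix.smul_mul, Matrix.mul_smul, Matrix.add_mul,
    Matrix.mul_add, Matrix.one_mul, Matrix.mul_one]
  have := op_mul_comm q b
  rw [show (equivString n q).op * (equivString n b).op = _ from this, smul_smul, mul_comm]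
  rfl

/-- All states that share a hidden state are compatible with the same outcomes of two successive
Pauli measurements. -/
theorem IsStochastic.exists_outcomes {V T k n : ℕ}
    {p : (ℕ → PauliString n) → (ℕ → Fin k → Fin 2) → ℕ → Fin V → ℝ}
    {K : ℕ → Fin V → PauliString n → (Fin k → Fin 2) → Fin V → ℝ} {r : Readout n k}
    {c : BBQC (Fin T × Fin k) (Fin T → PauliString n)}
    (hp : IsStochastic p K) (hpat : SamePattern p c) (hsim : Simulates r c) {t : ℕ} (ht : t + 2 < T)
    (h : Fin V) (P : PauliString n) : ∃ s, ∀ Q : PauliString n, ∃ s', ∀ ψ : QState n,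
      h ∈ hiddenSupport r p t (Submodule.span ℂ {ψ}) → Q.proj s' *ᵥ (P.proj s *ᵥ ψ) ≠ 0 := by
  -- The order of choices matters: `w` depends only on `h` and `P`, `w'` also on `Q`, and neither on
  -- the quantum state.
  obtain ⟨w, h', hK⟩ := hp.exists_kernel_ne_zero t h P
  refine ⟨r.outcome w, fun Q => ?_⟩
  obtain ⟨w', h'', hK'⟩ := hp.exists_kernel_ne_zero (t + 1) h' Q
  obtain ⟨s', hs'⟩ := PauliVec.exists_proj_mul_op Q (r.byproduct w) (r.outcome w')
  refine ⟨s', ?_⟩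
  rintro ψ ⟨x, y, hxy, hspan⟩ hzero
  have h1 := hp.step_ne_zero (hp.step_ne_zero hxy hK) hK'
  have h2 := hp.register_ne_zero hpat hsim ht h1
  rw [r.register_update_update, r.register_update_update] at h2
  have hmem : r.register x y t ∈ Submodule.span ℂ {ψ} := by
    rw [← hspan]; exact Submodule.mem_span_singleton_self _
  obtain ⟨a, ha⟩ := Submodule.mem_span_singleton.1 hmem
  apply h2
  rw [← ha]
  simp only [mulVec_smul]
  rw [mulVec_mulVec (P.proj _ *ᵥ ψ), hs', ← mulVec_mulVec, hzero, mulVec_zero, mulVec_zero,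
    smul_zero]

namespace PauliVec

variable {n : ℕ}

theorem sign_eq_of_proj_ne_zero {v : PauliVec n} {χ : QState n} {a : ℂ} {s : Fin 2}
    (hχ : v.toString.proj s *ᵥ χ ≠ 0) (ha : v.op *ᵥ χ = a • χ) : (-1 : ℂ) ^ (s : ℕ) = a := by
  have hχ0 : χ ≠ 0 := by rintro rfl; simp at hχ
  have h1 := eigenvalue_mul_self hχ0 ha
  have h2 : v.toString.proj s *ᵥ χ = (1 / 2 * (1 + (-1) ^ (s : ℕ) * a)) • χ := by
    rw [PauliString.proj, smul_mulVec, add_mulVec, one_mulVec, smul_mulVec, ha]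
    module
  rw [h2] at hχ
  rcases mul_self_eq_one_iff.1 h1 with rfl | rfl <;>
    rcases mul_self_eq_one_iff.1 (sign_mul_self s) with h3 | h3 <;> rw [h3] at hχ ⊢ <;>
    simp at hχ

theorem op_mulVec_proj (v : PauliVec n) (s : Fin 2) (χ : QState n) :
    v.op *ᵥ (v.toString.proj s *ᵥ χ) = (-1 : ℂ) ^ (s : ℕ) • (v.toString.proj s *ᵥ χ) := by
  simp only [PauliString.proj, smul_mulVec, add_mulVec, one_mulVec, mulVec_smul, mulVec_add,
    mulVec_mulVec, PauliString.op_mul_self, smul_add, smul_smul]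
  rw [mul_comm ((-1 : ℂ) ^ (s : ℕ)) (1 / 2 * _), mul_assoc, sign_mul_self,
    mul_comm ((-1 : ℂ) ^ (s : ℕ)) (1 / 2), mul_one, add_comm]

theorem op_mulVec_proj_of_symp {v w : PauliVec n} (hvw : symp n v w = 0) {s : Fin 2}
    {χ : QState n} {a : ℂ} (ha : v.op *ᵥ χ = a • χ) :
    v.op *ᵥ (w.toString.proj s *ᵥ χ) = a • (w.toString.proj s *ᵥ χ) := by
  have h := op_mul_comm v w
  rw [hvw, signChar_zero, one_smul] at h
  have h2 : v.op * w.toString.proj s = w.toString.proj s * v.op := by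
    simp only [PauliString.proj, Matrix.mul_smul, Matrix.smul_mul, Matrix.mul_add, Matrix.add_mul,
      Matrix.one_mul, Matrix.mul_one]
    rw [h]
  rw [mulVec_mulVec, h2, ← mulVec_mulVec, ha, mulVec_smul]

/-- If two successive Pauli measurements have outcomes that are compatible with all states of a
family of vectors, then the signs of the stabilizers are consistent. -/
theorem exists_consistentSigns (𝓕 : Set (QState n))
    (h : ∀ P : PauliString n, ∃ s, ∀ Q : PauliString n, ∃ s', ∀ ψ ∈ 𝓕,
      Q.proj s' *ᵥ (P.proj s *ᵥ ψ) ≠ 0) :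
    ∃ ε : PauliVec n → ℂ, (∀ ψ ∈ 𝓕, ∀ v a, v.op *ᵥ ψ = a • ψ → a = ε v) ∧
      ConsistentSigns {v | ∃ ψ ∈ 𝓕, v ∈ stabSpace ψ} fun v => ε v • v.op := by
  choose s hs using h
  set ε : PauliVec n → ℂ := fun v => (-1) ^ (s v.toString : ℕ) with hε
  have hεε : ∀ v, ε v * ε v = 1 := fun v => sign_mul_self _
  have hval : ∀ ψ ∈ 𝓕, ∀ v a, v.op *ᵥ ψ = a • ψ → a = ε v := by
    intro ψ hψ v a ha
    obtain ⟨s', hs'⟩ := hs v.toString v.toString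
    have h1 : v.toString.proj (s v.toString) *ᵥ ψ ≠ 0 := by
      intro h0
      apply hs' ψ hψ
      rw [h0, mulVec_zero]
    exact (sign_eq_of_proj_ne_zero h1 ha).symm
  refine ⟨ε, hval, fun v => ⟨ε v, hεε v, rfl⟩, ?_⟩
  rintro v ⟨ψ, hψ, a, ha⟩ w ⟨φ, hφ, b, hb⟩ hvw
  obtain rfl := hval ψ hψ v a ha
  obtain rfl := hval φ hφ w b hb
  obtain ⟨c, hc, hmul⟩ := exists_op_mul_of_symp hvw
  -- Measure `v + w`, then `v`. Starting from `ψ`, the second outcome is `ε v`, since `v` commutes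
  -- with `v + w`. Starting from `φ`, `w` keeps the value `ε w`, so the outcome is `c * ε w * ε (v +
  -- w)`. The common `s'` equates the two.
  obtain ⟨s', hs'⟩ := hs (v + w).toString v.toString
  have hv : symp n v (v + w) = 0 := by rw [map_add, hvw, symp_self, add_zero]
  have hw : symp n w (v + w) = 0 := by rw [map_add, symp_comm w v, hvw, symp_self, add_zero]
  have e1 := sign_eq_of_proj_ne_zero (hs' ψ hψ) (op_mulVec_proj_of_symp hv ha)
  have e2 : v.op *ᵥ ((v + w).toString.proj (s (v + w).toString) *ᵥ φ) =
      (c * (ε w * ε (v + w))) • ((v + w).toString.proj (s (v + w).toString) *ᵥ φ) := by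
    have h1 : v.op = c • ((v + w).op * w.op) := by
      rw [← smul_mul_assoc, ← hmul, Matrix.mul_assoc, PauliString.op_mul_self, Matrix.mul_one]
    conv_lhs => rw [h1]
    rw [smul_mulVec, ← mulVec_mulVec, op_mulVec_proj_of_symp hw hb, mulVec_smul, op_mulVec_proj,
      smul_smul, smul_smul, mul_assoc]
  have e3 := sign_eq_of_proj_ne_zero (hs' φ hφ) e2
  rw [e1] at e3
  rw [smul_mul_smul_comm, hmul, smul_smul]
  congr 1
  rw [e3]
  linear_combination (ε (v + w) * ε w * ε w) * hc + ε (v + w) * hεε w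

end PauliVec

/-- At most `2 ^ (n² / 4 + O(n))` stabilizer states share a hidden state. -/
theorem maxShared_le {V T k n : ℕ}
    {p : (ℕ → PauliString n) → (ℕ → Fin k → Fin 2) → ℕ → Fin V → ℝ}
    {K : ℕ → Fin V → PauliString n → (Fin k → Fin 2) → Fin V → ℝ} {r : Readout n k}
    {c : BBQC (Fin T × Fin k) (Fin T → PauliString n)}
    (hp : IsStochastic p K) (hpat : SamePattern p c) (hsim : Simulates r c) {t : ℕ}
    (ht : t + 2 < T) : maxShared r p t ≤ 2 ^ (n ^ 2 / 4 + 6 * n) := by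
  classical
  refine csSup_le' ?_
  rintro m ⟨s, hs, ⟨h, hh⟩, rfl⟩
  have hmem : ∀ W ∈ s, h ∈ hiddenSupport r p t W := fun W hW => by
    simpa using Set.mem_iInter₂.1 hh W hW
  have hrep : ∀ W ∈ s, ∃ ψ : QState n, IsStabilizerState ψ ∧ W = Submodule.span ℂ {ψ} :=
    fun W hW => hs hW
  choose! ψ hψ hWψ using hrep
  obtain ⟨ε, hval, hcons⟩ := PauliVec.exists_consistentSigns (n := n) {φ | ∃ W ∈ s, φ = ψ W}
    (fun P => by
      obtain ⟨o, ho⟩ := hp.exists_outcomes hpat hsim ht h P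
      refine ⟨o, fun Q => ?_⟩
      obtain ⟨o', ho'⟩ := ho Q
      refine ⟨o', ?_⟩
      rintro _ ⟨W, hW, rfl⟩
      exact ho' _ (by rw [← hWψ W hW]; exact hmem W hW))
  -- The signs are common to the family, so the Lagrangian subspace alone determines the state.
  have hinj : Set.InjOn (fun W => stabSpace (ψ W)) (s : Set (Submodule ℂ (QState n))) := by
    intro W hW W' hW' heq
    rw [hWψ W hW, hWψ W' hW']
    refine ((hψ W hW).span_eq_of_eigen (hψ W' hW').1 fun v a ha => ?_).symm
    have hv : v ∈ stabSpace (ψ W') := by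
      rw [← show stabSpace (ψ W) = stabSpace (ψ W') from heq]; exact ⟨a, ha⟩
    obtain ⟨b, hb⟩ := hv
    rw [hval _ ⟨W, hW, rfl⟩ v a ha, ← hval _ ⟨W', hW', rfl⟩ v b hb]
    exact hb
  rw [← Finset.card_image_of_injOn hinj]
  refine hcons.card_le _ ?_ ?_
  · intro L hL
    obtain ⟨W, hW, rfl⟩ := Finset.mem_image.1 hL
    exact (hψ W hW).orthogonal_stabSpace
  · intro L hL v hv
    obtain ⟨W, hW, rfl⟩ := Finset.mem_image.1 hL
    exact ⟨_, ⟨W, hW, rfl⟩, hv⟩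

/-- Each state has a hidden state in its support, and each hidden state serves at most `maxShared`
states. -/
theorem ncard_le_mul_maxShared {V n k : ℕ} (r : Readout n k)
    (p : (ℕ → PauliString n) → (ℕ → Fin k → Fin 2) → ℕ → Fin V → ℝ) (t : ℕ)
    (hne : ∀ W ∈ stabilizerStates n, (hiddenSupport r p t W).Nonempty) :
    (stabilizerStates n).ncard ≤ V * maxShared r p t := by
  classical
  set F := (stabilizerStates_finite n).toFinset with hF
  have hFmem : ∀ {W}, W ∈ F ↔ W ∈ stabilizerStates n := fun {W} => Set.Finite.mem_toFinset _
  -- The supremum of an unbounded set of naturals is 0 by convention, so boundedness has to be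
  -- shown.
  have hbdd : BddAbove {m | ∃ s : Finset (Submodule ℂ (QState n)),
      (s : Set (Submodule ℂ (QState n))) ⊆ stabilizerStates n ∧
      (⋂ W ∈ s, hiddenSupport r p t W).Nonempty ∧ s.card = m} := by
    refine ⟨F.card, ?_⟩
    rintro m ⟨s, hs, -, rfl⟩
    exact Finset.card_le_card fun W hW => hFmem.2 (hs hW)
  rw [Set.ncard_eq_toFinset_card _ (stabilizerStates_finite n)]
  have hcov : F ⊆ (Finset.univ : Finset (Fin V)).biUnion fun h =>
      F.filter fun W => h ∈ hiddenSupport r p t W := by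
    intro W hW
    obtain ⟨h, hh⟩ := hne W (hFmem.1 hW)
    exact Finset.mem_biUnion.2 ⟨h, Finset.mem_univ _, Finset.mem_filter.2 ⟨hW, hh⟩⟩
  refine (Finset.card_le_card hcov).trans (Finset.card_biUnion_le.trans ?_)
  refine (Finset.sum_le_card_nsmul _ _ (maxShared r p t) fun h _ => ?_).trans_eq (by simp)
  refine le_csSup hbdd ⟨_, ?_, ⟨h, ?_⟩, rfl⟩
  · intro W hW
    exact hFmem.1 (Finset.mem_filter.1 hW).1
  · exact Set.mem_iInter₂.2 fun W hW => (Finset.mem_filter.1 hW).2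

/-! ## Preparation of all stabilizer states -/

section Preparation

variable {n : ℕ}

theorem PauliString.proj_zero_toString_zero :
    (PauliVec.toString (0 : PauliVec n)).proj 0 = 1 := by
  rw [PauliString.proj, show (PauliVec.toString (0 : PauliVec n)).op = 1 from PauliVec.op_zero]
  ext i j
  simp
  ring

theorem exists_register_succ {t : ℕ} {φ : QState n}
    (h : ∃ x y, (teleportReadout n).register x y t = φ) (P B : PauliString n) (s : Fin 2) :
    ∃ x y, (teleportReadout n).register x y (t + 1) = B.op *ᵥ (P.proj s *ᵥ φ) := by
  obtain ⟨x, y, rfl⟩ := h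
  obtain ⟨w, rfl, rfl⟩ := exists_readout s B
  exact ⟨_, _, Readout.register_update_update _ x y t P w⟩

theorem exists_register_of_le {t t' : ℕ} (htt : t ≤ t') {φ : QState n}
    (h : ∃ x y, (teleportReadout n).register x y t = φ) :
    ∃ x y, (teleportReadout n).register x y t' = φ := by
  induction t', htt using Nat.le_induction with
  | base => exact h
  | succ t' _ ih =>
    have := exists_register_succ ih (PauliVec.toString 0) (PauliVec.toString 0) 0
    rwa [PauliString.proj_zero_toString_zero, one_mulVec,
      show (PauliVec.toString (0 : PauliVec n)).op = 1 from PauliVec.op_zero, one_mulVec] at this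

/-- The result of projecting successively on eigenspaces of Pauli operators. -/
noncomputable def projList (l : List (Fin 2 × PauliVec n)) (φ : QState n) : QState n :=
  l.foldl (fun φ g => g.2.toString.proj g.1 *ᵥ φ) φ

theorem exists_register_projList (l : List (Fin 2 × PauliVec n)) {t : ℕ} {φ : QState n}
    (h : ∃ x y, (teleportReadout n).register x y t = φ) :
    ∃ x y, (teleportReadout n).register x y (t + l.length) = projList l φ := by
  induction l generalizing t φ with
  | nil => exact h
  | cons g l ih =>
    have h1 := exists_register_succ h g.2.toString (PauliVec.toString 0) g.1
    rw [show (PauliVec.toString (0 : PauliVec n)).op = 1 from PauliVec.op_zero, one_mulVec] at h1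
    have h2 := ih h1
    rw [List.length_cons, add_comm l.length, ← add_assoc]
    exact h2

theorem ip_proj {ψ φ : QState n} {v : PauliVec n} {s : Fin 2}
    (h : v.op *ᵥ ψ = (-1 : ℂ) ^ (s : ℕ) • ψ) :
    QState.ip ψ (v.toString.proj s *ᵥ φ) = QState.ip ψ φ := by
  rw [PauliString.proj, smul_mulVec, add_mulVec, one_mulVec, smul_mulVec, QState.ip_smul,
    QState.ip_add, QState.ip_smul, show v.toString.op = v.op from rfl, QState.ip_op_comm, h,
    QState.ip_smul_left, star_eq_of_mul_self (PauliVec.sign_mul_self s), ← mul_assoc,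
    PauliVec.sign_mul_self]
  ring

/-- Every projector fixes `ψ`, so the overlap with `ψ` survives, and in particular the result stays
nonzero if the overlap was. The stabilizers commute, so later projections keep earlier eigenvalues.
-/
theorem projList_spec {ψ : QState n} (hψ : ψ ≠ 0) (φ : QState n) (l : List (Fin 2 × PauliVec n))
    (hl : ∀ g ∈ l, g.2.op *ᵥ ψ = (-1 : ℂ) ^ (g.1 : ℕ) • ψ) :
    QState.ip ψ (projList l φ) = QState.ip ψ φ ∧
      ∀ g ∈ l, g.2.op *ᵥ projList l φ = (-1 : ℂ) ^ (g.1 : ℕ) • projList l φ := by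
  induction l using List.reverseRecOn with
  | nil => simp [projList]
  | append_singleton l g ih =>
    have hg := hl g (by simp)
    obtain ⟨ih1, ih2⟩ := ih fun g' hg' => hl g' (by simp [hg'])
    have happ : projList (l ++ [g]) φ = g.2.toString.proj g.1 *ᵥ projList l φ := by
      simp [projList]
    rw [happ]
    refine ⟨by rw [ip_proj hg, ih1], fun g' hg' => ?_⟩
    rcases List.mem_append.1 hg' with h | h
    · exact PauliVec.op_mulVec_proj_of_symp
        (PauliVec.symp_eq_zero_of_eigen hψ (hl g' hg') hg) (ih2 g' h)
    · rw [List.mem_singleton] at h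
      subst h
      exact PauliVec.op_mulVec_proj _ _ _

/-- Every stabilizer state is prepared by a sequence of Pauli measurements. -/
theorem exists_register_span_eq {t : ℕ} (ht : n + 1 ≤ t) {W : Submodule ℂ (QState n)}
    (hW : W ∈ stabilizerStates n) :
    ∃ x y, Submodule.span ℂ {(teleportReadout n).register x y t} = W := by
  obtain ⟨ψ, hψ, rfl⟩ := hW
  have hz : zeroState n ≠ 0 := fun h => by simpa [zeroState] using congrFun h 0
  obtain ⟨b, hb⟩ : ∃ b : PauliVec n, QState.ip ψ (b.op *ᵥ zeroState n) ≠ 0 := by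
    by_contra hcon
    push Not at hcon
    rcases QState.eq_zero_of_ip_op_eq_zero hcon with h | h
    exacts [hψ.1 h, hz h]
  have hfr := (isStabilizerState_iff_finrank hψ.1).1 hψ
  let β := Module.finBasisOfFinrankEq (ZMod 2) (stabSpace ψ) hfr
  have hsign : ∀ i, ∃ s : Fin 2, (β i : PauliVec n).op *ᵥ ψ = (-1 : ℂ) ^ (s : ℕ) • ψ := by
    intro i
    obtain ⟨a, ha⟩ := (β i).2
    obtain ⟨s, rfl⟩ := PauliVec.exists_sign (PauliVec.eigenvalue_mul_self hψ.1 ha)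
    exact ⟨s, ha⟩
  choose s hs using hsign
  let l : List (Fin 2 × PauliVec n) := List.ofFn fun i => (s i, (β i : PauliVec n))
  have hl : ∀ g ∈ l, g.2.op *ᵥ ψ = (-1 : ℂ) ^ (g.1 : ℕ) • ψ := by
    intro g hg
    obtain ⟨i, rfl⟩ := (List.mem_ofFn' _ _).1 hg
    exact hs i
  obtain ⟨h1, h2⟩ := projList_spec hψ.1 (b.op *ᵥ zeroState n) l hl
  have hreach : ∃ x y, (teleportReadout n).register x y t =
      projList l (b.op *ᵥ zeroState n) := by
    -- Round 0 measures the identity and uses only the byproduct `b`; the next `n` rounds measure a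
    -- basis of the stabilizer space, and any remaining rounds are idle.
    have h3 := exists_register_succ (t := 0) (φ := zeroState n)
      ⟨fun _ => PauliVec.toString 0, fun _ _ => 0, rfl⟩ (PauliVec.toString 0) b.toString 0
    rw [PauliString.proj_zero_toString_zero, one_mulVec] at h3
    refine exists_register_of_le ?_ (exists_register_projList l h3)
    simp only [l, List.length_ofFn]
    omega
  obtain ⟨x, y, hxy⟩ := hreach
  refine ⟨x, y, ?_⟩
  rw [hxy]
  set φ := projList l (b.op *ᵥ zeroState n) with hφ
  refine hψ.span_eq_of_eigen ?_ fun v a ha => ?_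
  · intro h0
    rw [h0] at h1
    exact hb (by rw [← h1]; simp [QState.ip])
  · have hspan : v ∈ Submodule.span (ZMod 2) (Set.range fun i => (β i : PauliVec n)) := by
      have h3 := congrArg (Submodule.map (stabSpace ψ).subtype) β.span_eq
      rw [Submodule.map_span, Submodule.map_top, Submodule.range_subtype, ← Set.range_comp] at h3
      exact h3.ge ⟨a, ha⟩
    obtain ⟨a', ha', hφa⟩ := eigen_of_mem_span (ψ := ψ) (φ := φ) (by
      rintro _ ⟨i, rfl⟩
      exact ⟨_, hs i, h2 (s i, β i) ((List.mem_ofFn' _ _).2 ⟨i, rfl⟩)⟩) hspan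
    rw [PauliVec.eigenvalue_unique hψ.1 (ha.symm.trans ha')]
    exact hφa

end Preparation

/-! ### The bound and its constants -/

theorem hiddenStateBound {V T n : ℕ}
    {p : (ℕ → PauliString n) → (ℕ → Fin (2 * n + 1) → Fin 2) → ℕ → Fin V → ℝ}
    {K : ℕ → Fin V → PauliString n → (Fin (2 * n + 1) → Fin 2) → Fin V → ℝ}
    (hp : IsStochastic p K) (hpat : SamePattern p (teleportCircuit n T)) {t : ℕ} (hn : n + 1 ≤ t)
    (ht : t + 2 < T) : HiddenStateBound 7 (teleportReadout n) p t := by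
  have hsim := teleportCircuit_simulates n T
  have hne : ∀ W ∈ stabilizerStates n, (hiddenSupport (teleportReadout n) p t W).Nonempty := by
    intro W hW
    obtain ⟨x, y, hxy⟩ := exists_register_span_eq hn hW
    have hreg : (teleportReadout n).register x y t ≠ 0 := by
      intro h0
      obtain ⟨ψ, hψ, rfl⟩ := hW
      rw [h0, Submodule.span_zero_singleton] at hxy
      exact hψ.1 (Submodule.span_singleton_eq_bot.1 hxy.symm)
    obtain ⟨h, hh⟩ := hp.exists_ne_zero hpat hsim (by omega) hreg
    exact ⟨h, x, y, hh, hxy⟩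
  have h1 := ncard_le_mul_maxShared (teleportReadout n) p t hne
  have h2 := two_pow_le_ncard_stabilizerStates n
  have h3 := maxShared_le hp hpat hsim ht
  set S := (stabilizerStates n).ncard
  set m := maxShared (teleportReadout n) p t
  have hSpos : 0 < S := lt_of_lt_of_le (by positivity) h2
  have hmpos : 0 < m := Nat.pos_of_ne_zero fun h0 => by rw [h0] at h1; omega
  have hm : (0 : ℝ) < m := by exact_mod_cast hmpos
  refine ⟨?_, ?_⟩
  · rw [le_div_iff₀ hm]
    have h2' : (2 : ℝ) ^ (((n * (n - 1) / 2 : ℕ) : ℝ)) ≤ S := by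
      rw [Real.rpow_natCast]; exact_mod_cast h2
    have h3' : (m : ℝ) ≤ (2 : ℝ) ^ (((n ^ 2 / 4 + 6 * n : ℕ) : ℝ)) := by
      rw [Real.rpow_natCast]; exact_mod_cast h3
    refine le_trans ?_ h2'
    refine (mul_le_mul_of_nonneg_left h3' (by positivity)).trans ?_
    rw [← Real.rpow_add (by norm_num)]
    refine Real.rpow_le_rpow_of_exponent_le (by norm_num) ?_
    have e1 : (((n ^ 2 / 4 : ℕ)) : ℝ) ≤ (n : ℝ) ^ 2 / 4 := by
      have := Nat.cast_div_le (α := ℝ) (m := n ^ 2) (n := 4)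
      simpa using this
    have e2 : (((n * (n - 1) / 2 : ℕ)) : ℝ) = (n : ℝ) * (n - 1) / 2 := by
      rw [← Nat.choose_two_right, Nat.cast_choose_two]
    rw [e2]
    -- The exponents differ by `n (n - 1) / 2 - n² / 4 - 6 n = n² / 4 - 13 n / 2`, which explains
    -- the constant 7.
    push_cast at e1 ⊢
    have hn0 : (0 : ℝ) ≤ n := n.cast_nonneg
    nlinarith
  · rw [div_le_iff₀ hm]
    exact_mod_cast h1

theorem theorem2 :
    ∃ (k : ℕ → ℕ)
      (M : ∀ n T : ℕ, BBQC (Fin T × Fin (k n)) (Fin T → PauliString n))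
      (r : ∀ n : ℕ, Readout n (k n)) (C n₀ : ℕ) (c : ℝ),
      0 < c ∧
      -- basis-enhanced 2-gram models with nodes of dimension `D = 2 ^ k n`, `2 ^ n ≤ D = 2 ^ O(n)`
      (∀ n T : ℕ, (M n T).IsTwoGram) ∧
      (∀ n : ℕ, 1 ≤ n → 2 ^ n ≤ 2 ^ k n ∧ 2 ^ k n ≤ 2 ^ (C * n)) ∧
      -- which simulate Pauli measurements by teleportation gadgets
      (∀ n T : ℕ, 1 ≤ n → Simulates (r n) (M n T)) ∧
      -- on all stabilizer states
      (∀ n t : ℕ, 1 ≤ n → C * n ≤ t → ∀ W ∈ stabilizerStates n,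
        ∃ x y, Submodule.span ℂ {(r n).register x y t} = W) ∧
      -- every classical model with the same zero pattern needs `|S| / m ≥ 2 ^ (n² / 4 - C n)`
      -- hidden states
      (∀ n T t : ℕ, 1 ≤ n → C * n ≤ t → t + 2 < T → ∀ V : ℕ,
        (∀ H : TranslationHMM V (PauliString n) (Fin (k n) → Fin 2),
          SamePattern H.forward (M n T) → HiddenStateBound C (r n) H.forward t) ∧
        (∀ O : OntologicalModel V (PauliString n) (Fin (k n) → Fin 2),
          SamePattern O.forward (M n T) → HiddenStateBound C (r n) O.forward t)) ∧
      -- and this number is `D ^ Ω(log D)`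
      (∀ n : ℕ, n₀ ≤ n →
        ((2 : ℝ) ^ k n) ^ (c * Real.logb 2 ((2 : ℝ) ^ k n)) ≤
          (2 : ℝ) ^ ((n : ℝ) ^ 2 / 4 - C * n)) := by
  -- Since `2 n + 1 ≤ 3 n`, the factor `1 / 72` makes the left exponent at most `n² / 8`, and `n² /
  -- 8 ≤ n² / 4 - 7 n` holds from `n = 56` on.
  refine ⟨fun n => 2 * n + 1, teleportCircuit, teleportReadout, 7, 56, 1 / 72, by norm_num,
    teleportCircuit_isTwoGram, fun n hn => ⟨?_, ?_⟩, fun n T _ => teleportCircuit_simulates n T,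
    fun n t hn ht W hW => exists_register_span_eq (by omega) hW,
    fun n T t hn ht hT V => ⟨fun H hH => hiddenStateBound H.isStochastic hH (by omega) hT,
      fun O hO => hiddenStateBound O.isStochastic hO (by omega) hT⟩, fun n hn => ?_⟩
  · exact Nat.pow_le_pow_right (by norm_num) (by dsimp only; omega)
  · exact Nat.pow_le_pow_right (by norm_num) (by dsimp only; omega)
  · rw [← Real.rpow_natCast, ← Real.rpow_mul (by norm_num),
      Real.logb_rpow (by norm_num) (by norm_num)]
    refine Real.rpow_le_rpow_of_exponent_le (by norm_num) ?_
    have h : (56 : ℝ) ≤ n := by exact_mod_cast hn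
    push_cast
    nlinarith
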